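/- Consider $Q$ transmitter-receiver pairs, the $q$-th one with $n_{T_q}$ transmit and $n_{R_q}\ge 1$ receive antennas, channel matrices $\mathbf H_{qr}\in\mathbb C^{n_{R_q}\times n_{T_r}}$ from transmitter $r$ to receiver $q$, positive definite noise covariance matrices $\mathbf R_{n_q}$, maximum powers $P_q\ge 0$ and circuit powers $\Psi_q>0$. In the energy efficiency (EE) game, player $q$ chooses a positive semidefinite $\mathbf Q_q\in\mathbb C^{n_{T_q}\times n_{T_q}}$ with $\operatorname{Tr}\mathbf Q_q\le P_q$ so as to maximize $$\mathrm{EE}_q(\mathbf Q_q,\mathbf Q_{-q})=\frac{\log\det\big(\mathbf I+\mathbf H_{qq}^H\mathbf R_{-q}^{-1}\mathbf H_{qq}\mathbf Q_q\big)}{\Psi_q+\operatorname{Tr}\mathbf Q_q},\qquad \mathbf R_{-q}=\mathbf R_{n_q}+\sum_{r\ne q}\mathbf H_{qr}\mathbf Q_r\mathbf H_{qr}^H .$$ A (pure) Nash equilibrium is a profile of admissible strategies, each of which maximizes the EE of its player when the other strategies are fixed. Let $\mathbf H_{qq}=\mathbf U_{q,1}\mathbf\Sigma_{qq}\mathbf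 V_{q,1}^H$ be compact singular value decompositions, with $r_q=\operatorname{rank}\mathbf H_{qq}$, and put $\overline{\mathbf H}_{qr}=\mathbf H_{qr}\mathbf V_{r,1}\in\mathbb C^{n_{R_q}\times r_r}$. Let $\overline{\mathcal Q}(\mathbf p)$ be the set of all $\overline{\mathbf Q}=(\overline{\mathbf Q}_1,\dots,\overline{\mathbf Q}_Q)$ with $\overline{\mathbf Q}_q\in\mathbb C^{r_q\times r_q}$ positive semidefinite and $\operatorname{Tr}\overline{\mathbf Q}_q\le P_q$, and let $\overline{\mathrm{EE}}_q$ be defined as $\mathrm{EE}_q$ with all $\mathbf H_{qr}$ replaced by $\overline{\mathbf H}_{qr}$. For $\overline{\mathbf Q}\in\overline{\mathcal Q}(\mathbf p)$, let $\hat{\mathbf p}(\overline{\mathbf Q})\in\mathbb R^Q$ have the components $\min(P_q,\hat P^u_q)$, where $\hat P^u_q$ is the trace of the maximizer of $\overline{\mathrm{EE}}_q(\cdot,\overline{\mathbf Q}_{-q})$ over all positive semidefinite $r_q\times r_q$ matrices. Assume that all $\overline{\mathbf H}_{qq}$ are square and nonsingular, and let $\overline{\mathbf S}\in\mathbb R^{Q\times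 Q}$ have the entries $[\overline{\mathbf S}]_{qr}=\sigma_{\max}^2\big(\overline{\mathbf H}_{qq}^{-1}\overline{\mathbf H}_{qr}\big)$ for $r\ne q$ and $[\overline{\mathbf S}]_{qq}=0$, with symmetric part $\overline{\mathbf S}^s=\frac12(\overline{\mathbf S}+\overline{\mathbf S}^T)$. If $$\big\|\hat{\mathbf p}(\overline{\mathbf Q})-\hat{\mathbf p}(\overline{\mathbf Q}')\big\|_2<\frac{1-\rho(\overline{\mathbf S}^s)}{\sigma_{\max}(\mathbf I_Q+\overline{\mathbf S})}\,\big\|\overline{\mathbf Q}-\overline{\mathbf Q}'\big\|_F\qquad\text{for all }\overline{\mathbf Q}\ne\overline{\mathbf Q}'\text{ in }\overline{\mathcal Q}(\mathbf p),$$ where $\rho$ is the spectral radius and $\sigma_{\max}$ the largest singular value, then the EE game has exactly one Nash equilibrium. -/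

import Mathlib

open scoped Matrix ComplexOrder

noncomputable section

/-- A MIMO interference network with `Q` transmitter-receiver pairs, `nR q` antennas at the `q`-th
receiver and `nT q` antennas at the `q`-th transmitter. -/
structure MIMONetwork (Q : ℕ) (nR nT : Fin Q → ℕ) where
  /-- `H q r` is the channel from the `r`-th transmitter to the `q`-th receiver. -/
  H : (q r : Fin Q) → Matrix (Fin (nR q)) (Fin (nT r)) ℂ
  /-- The noise covariance matrix at the `q`-th receiver. -/
  Rn : (q : Fin Q) → Matrix (Fin (nR q)) (Fin (nR q)) ℂ
  /-- The maximum mean emitted power of the `q`-th transmitter. -/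
  P : Fin Q → ℝ
  /-- The hardware circuitry power consumed by the `q`-th transmitter. -/
  Psi : Fin Q → ℝ
  Rn_posDef : ∀ q, (Rn q).PosDef
  P_nonneg : ∀ q, 0 ≤ P q
  Psi_pos : ∀ q, 0 < Psi q

/-- Strategy profiles: one square complex matrix of size `n q` for each player `q`. -/
abbrev Profile {Q : ℕ} (n : Fin Q → ℕ) : Type :=
  (q : Fin Q) → Matrix (Fin (n q)) (Fin (n q)) ℂ

namespace MIMONetwork

variable {Q : ℕ} {nR nT : Fin Q → ℕ}

/-- The strategy set of player `q`: positive semidefinite (in particular Hermitian) matrices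
whose trace is at most `P q`. -/
def strategySet (G : MIMONetwork Q nR nT) (q : Fin Q) :
    Set (Matrix (Fin (nT q)) (Fin (nT q)) ℂ) :=
  {X | X.PosSemidef ∧ X.trace.re ≤ G.P q}

/-- The set of admissible strategy profiles (the product of the strategy sets). -/
def profileSet (G : MIMONetwork Q nR nT) : Set (Profile nT) :=
  {Y | ∀ q, Y q ∈ G.strategySet q}

/-- The interference-plus-noise covariance matrix at receiver `q`. It depends only on the
strategies in `Y` of the players other than `q`. -/
def interferenceCov (G : MIMONetwork Q nR nT) (q : Fin Q) (Y : Profile nT) :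
    Matrix (Fin (nR q)) (Fin (nR q)) ℂ :=
  G.Rn q + ∑ r ∈ Finset.univ.erase q, G.H q r * Y r * (G.H q r)ᴴ

/-- The rate `log det (I + Hᴴ R⁻¹ H X)` of player `q` when it plays `X` and the other players
play as in `Y`. On admissible strategies the determinant is a positive real number. -/
def rate (G : MIMONetwork Q nR nT) (q : Fin Q) (X : Matrix (Fin (nT q)) (Fin (nT q)) ℂ)
    (Y : Profile nT) : ℝ :=
  Real.log (1 + (G.H q q)ᴴ * (G.interferenceCov q Y)⁻¹ * G.H q q * X).det.re

/-- The energy efficiency of player `q` when it plays `X` and the other players play as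
in `Y`. -/
def energyEff (G : MIMONetwork Q nR nT) (q : Fin Q) (X : Matrix (Fin (nT q)) (Fin (nT q)) ℂ)
    (Y : Profile nT) : ℝ :=
  G.rate q X Y / (G.Psi q + X.trace.re)

/-- `Y` is a (pure) Nash equilibrium of the energy efficiency game: each `Y q` is an admissible
strategy which maximizes the energy efficiency of player `q` over its strategy set, the other
strategies being fixed. -/
def IsNashEquilibrium (G : MIMONetwork Q nR nT) (Y : Profile nT) : Prop :=
  ∀ q, Y q ∈ G.strategySet q ∧
    ∀ X ∈ G.strategySet q, G.energyEff q X Y ≤ G.energyEff q (Y q) Y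

/-- The maximizers of the energy efficiency of player `q` over all positive semidefinite
matrices (no constraint on the power). -/
def unconstrainedArgmax (G : MIMONetwork Q nR nT) (q : Fin Q) (Y : Profile nT) :
    Set (Matrix (Fin (nT q)) (Fin (nT q)) ℂ) :=
  {X | X.PosSemidef ∧ ∀ Z : Matrix (Fin (nT q)) (Fin (nT q)) ℂ,
    Z.PosSemidef → G.energyEff q Z Y ≤ G.energyEff q X Y}

/-- The unconstrained optimal power: the trace of the maximizer. When `G.H q q` has full column
rank there is exactly one maximizer, so the supremum is over a singleton. -/
def unconstrainedPower (G : MIMONetwork Q nR nT) (q : Fin Q) (Y : Profile nT) : ℝ :=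
  sSup ((fun X => X.trace.re) '' G.unconstrainedArgmax q Y)

/-- The optimal power mapping: the componentwise minimum of the maximum power and of the
unconstrained optimal power. -/
def powerMap (G : MIMONetwork Q nR nT) (Y : Profile nT) : EuclideanSpace ℝ (Fin Q) :=
  WithLp.toLp 2 (fun q => min (G.P q) (G.unconstrainedPower q Y))

/-- The network with channels `H q r * V r`, obtained when transmitter `r` uses strategies of the
form `V r * X * (V r)ᴴ`. -/
def reduce {n : Fin Q → ℕ} (G : MIMONetwork Q nR nT)
    (V : (q : Fin Q) → Matrix (Fin (nT q)) (Fin (n q)) ℂ) : MIMONetwork Q nR n where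
  H q r := G.H q r * V r
  Rn := G.Rn
  P := G.P
  Psi := G.Psi
  Rn_posDef := G.Rn_posDef
  P_nonneg := G.P_nonneg
  Psi_pos := G.Psi_pos

end MIMONetwork

/-- `A = U Σ Vᴴ` is a compact singular value decomposition: `U` and `V` have orthonormal columns
and `Σ` is diagonal with positive entries `s i`. The number `r` of columns is then the rank
of `A`. -/
def IsCompactSVD {m n r : ℕ} (A : Matrix (Fin m) (Fin n) ℂ) (U : Matrix (Fin m) (Fin r) ℂ)
    (s : Fin r → ℝ) (V : Matrix (Fin n) (Fin r) ℂ) : Prop :=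
  Uᴴ * U = 1 ∧ Vᴴ * V = 1 ∧ (∀ i, 0 < s i) ∧
    A = U * Matrix.diagonal (fun i => (s i : ℂ)) * Vᴴ

/-- The spectral radius of a square complex matrix, as a real number. -/
def specRadius {n : ℕ} (A : Matrix (Fin n) (Fin n) ℂ) : ℝ :=
  (spectralRadius ℂ A).toReal

/-- The maximum singular value: the square root of the largest eigenvalue of `Aᴴ * A`. -/
def sigmaMax {m n : ℕ} (A : Matrix (Fin m) (Fin n) ℂ) : ℝ :=
  Real.sqrt (specRadius (Aᴴ * A))

/-- The Frobenius norm of a tuple of matrices. -/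
def profileNorm {Q : ℕ} {n : Fin Q → ℕ} (E : Profile n) : ℝ :=
  Real.sqrt (∑ q, ∑ i, ∑ j, ‖E q i j‖ ^ 2)

/-- The interference matrix of a network with square direct channels:
`σ_max (H_qq⁻¹ H_qr) ^ 2` off the diagonal and zero on the diagonal. -/
def MIMONetwork.interferenceMatrix {Q : ℕ} {n : Fin Q → ℕ} (G : MIMONetwork Q n n) :
    Matrix (Fin Q) (Fin Q) ℝ :=
  Matrix.of fun q r => if r = q then 0 else sigmaMax ((G.H q q)⁻¹ * G.H q r) ^ 2

/-- The symmetric part of a real square matrix. -/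
def symmPart {n : ℕ} (A : Matrix (Fin n) (Fin n) ℝ) : Matrix (Fin n) (Fin n) ℝ :=
  (1 / 2 : ℝ) • (A + Aᵀ)

end

/-! Suppose first that the direct channels are square and invertible. Multiplying by $H_{qq}^{-1}$
turns the rate of player $q$ into $\log\det(I+W^{-1}X)$, where $W=H_{qq}^{-1}R_{-q}H_{qq}^{-H}$ is
affine in the other strategies. The EE is a strictly concave function over a positive affine one,
hence strictly quasiconcave. The best response is therefore the water-filling solution of power
$\min(P_q,\hat P^u_q)$ (`effEE_bestResponse_iff`).

Water-filling at a fixed power is defined by the variational inequality of $X\mapsto W+X$ on the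
matrices of that trace. Collected over the players, these inequalities form the one for `viMap`,
which is strongly monotone with constant $c=1-\rho(\overline S^s)$ and Lipschitz with constant
$L=\sigma_{\max}(I+\overline S)$. So every power vector $p$ has a water-filling profile $X(p)$, and
the equilibria are the water-filling profiles with $p=\hat p(X)$ (`isNashEquilibrium_iff`).

The decisive estimate compares profiles of different powers: $c\,\|X-X'\|^2\le
L\,\|X-X'\|\,\|p-p'\|$. It holds because water levels are least eigenvalues, which move by at most
the Frobenius distance. With the hypothesis, $p\mapsto\hat p(X(p))$ strictly decreases distances on
a compact box, so Edelstein's theorem gives a fixed point. The same two inequalities contradict each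
other for two distinct equilibria.

In general, power outside the row space of $H_{qq}$ costs without adding rate, so the equilibria are
exactly the $VZV^H$ with $Z$ an equilibrium of the reduced game
(`isNashEquilibrium_iff_exists_expand`). -/

namespace Matrix

variable {ι : Type*} [Fintype ι]

/-! ### Positive semidefinite matrices: traces, least eigenvalues, concavity of log det,
compactness. -/

open scoped MatrixOrder in
lemma PosSemidef.exists_eq_conjTranspose_mul_self {A : Matrix ι ι ℂ} (hA : A.PosSemidef) :
    ∃ C : Matrix ι ι ℂ, A = Cᴴ * C :=
  by classical exact CStarAlgebra.nonneg_iff_eq_star_mul_self.mp hA.nonneg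

lemma PosSemidef.trace_re_nonneg {A : Matrix ι ι ℂ} (hA : A.PosSemidef) : 0 ≤ A.trace.re :=
  (Complex.le_def.1 hA.trace_nonneg).1

lemma PosSemidef.trace_eq_re {A : Matrix ι ι ℂ} (hA : A.PosSemidef) : A.trace = A.trace.re :=
  (Complex.ext rfl (by simpa using (Complex.le_def.1 hA.trace_nonneg).2.symm))

lemma PosSemidef.eq_zero_of_trace_re {A : Matrix ι ι ℂ} (hA : A.PosSemidef)
    (h : A.trace.re ≤ 0) : A = 0 := by
  rw [← hA.trace_eq_zero_iff, hA.trace_eq_re, le_antisymm h hA.trace_re_nonneg]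
  simp

lemma PosSemidef.trace_mul_re_nonneg {A B : Matrix ι ι ℂ} (hA : A.PosSemidef)
    (hB : B.PosSemidef) : 0 ≤ (A * B).trace.re := by
  obtain ⟨C, rfl⟩ := hA.exists_eq_conjTranspose_mul_self
  rw [mul_assoc, trace_mul_comm]
  exact (hB.mul_mul_conjTranspose_same C).trace_re_nonneg

/-- With $A=C^HC$ and $B=D^HD$ the trace is $\|DC^H\|_F^2$. This is the source of the complementary
slackness relations below. -/
lemma PosSemidef.mul_eq_zero_of_trace_re {A B : Matrix ι ι ℂ} (hA : A.PosSemidef)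
    (hB : B.PosSemidef) (h : (A * B).trace.re ≤ 0) : A * B = 0 := by
  obtain ⟨C, rfl⟩ := hA.exists_eq_conjTranspose_mul_self
  obtain ⟨D, rfl⟩ := hB.exists_eq_conjTranspose_mul_self
  have e : (D * Cᴴ)ᴴ * (D * Cᴴ) = C * (Dᴴ * D) * Cᴴ := by
    simp [conjTranspose_mul, mul_assoc]
  have h0 : D * Cᴴ = 0 := by
    rw [← conjTranspose_mul_self_eq_zero]
    apply (posSemidef_conjTranspose_mul_self _).eq_zero_of_trace_re
    rw [e, trace_mul_comm, ← mul_assoc]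
    exact h
  have h1 : C * Dᴴ = 0 := by
    rw [← conjTranspose_conjTranspose (C * Dᴴ), conjTranspose_mul, conjTranspose_conjTranspose, h0,
      conjTranspose_zero]
  calc Cᴴ * C * (Dᴴ * D) = Cᴴ * (C * Dᴴ) * D := by simp only [mul_assoc]
    _ = 0 := by rw [h1]; simp

/-- The least eigenvalue of a Hermitian matrix, with a unit eigenvector. -/
lemma IsHermitian.exists_least_eigenvector [DecidableEq ι] [Nonempty ι] {A : Matrix ι ι ℂ} (hA : A.IsHermitian) :
    ∃ (μ : ℝ) (v : ι → ℂ), star v ⬝ᵥ v = 1 ∧ A *ᵥ v = (μ : ℂ) • v ∧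
      (A - (μ : ℂ) • (1 : Matrix ι ι ℂ)).PosSemidef := by
  obtain ⟨i, hi⟩ := Finite.exists_min hA.eigenvalues
  refine ⟨hA.eigenvalues i, hA.eigenvectorBasis i, ?_, ?_, ?_⟩
  · have := hA.eigenvectorBasis.orthonormal.1 i
    rw [dotProduct_comm, ← EuclideanSpace.inner_eq_star_dotProduct, inner_self_eq_norm_sq_to_K,
      this]
    simp
  · rw [hA.mulVec_eigenvectorBasis]
    rfl
  · have h1 : A - (hA.eigenvalues i : ℂ) • (1 : Matrix ι ι ℂ) =
        (hA.eigenvectorUnitary : Matrix ι ι ℂ) *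
          diagonal (fun j => ((hA.eigenvalues j - hA.eigenvalues i : ℝ) : ℂ)) *
          (hA.eigenvectorUnitary : Matrix ι ι ℂ)ᴴ := by
      have h2 : diagonal (fun j => ((hA.eigenvalues j - hA.eigenvalues i : ℝ) : ℂ)) =
          diagonal (RCLike.ofReal ∘ hA.eigenvalues) -
            (hA.eigenvalues i : ℂ) • (1 : Matrix ι ι ℂ) := by
        ext a b
        by_cases hab : a = b <;> simp [hab]
      rw [h2, mul_sub, sub_mul, ← star_eq_conjTranspose, Matrix.mul_smul, Matrix.smul_mul, mul_one,
        Unitary.mul_star_self_of_mem hA.eigenvectorUnitary.2]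
      exact congrArg (· - _) hA.spectral_theorem
    rw [h1]
    refine PosSemidef.mul_mul_conjTranspose_same (posSemidef_diagonal_iff.2 fun j => ?_) _
    simpa using hi j

/-- Sum $\log\lambda\le\lambda-1$ over the eigenvalues; equality everywhere forces all eigenvalues
to be 1. -/
lemma PosDef.log_det_le [DecidableEq ι] {M : Matrix ι ι ℂ} (hM : M.PosDef) :
    Real.log M.det.re ≤ (M - 1).trace.re ∧ (M ≠ 1 → Real.log M.det.re < (M - 1).trace.re) := by
  have hdet : Real.log M.det.re = ∑ i, Real.log (hM.1.eigenvalues i) := by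
    rw [hM.1.det_eq_prod_eigenvalues, ← Real.log_prod fun i _ => (hM.eigenvalues_pos i).ne']
    congr 1
    rw [← Complex.ofReal_re (∏ i, hM.1.eigenvalues i)]
    push_cast
    rfl
  have htr : (M - 1).trace.re = ∑ i, (hM.1.eigenvalues i - 1) := by
    rw [trace_sub, hM.1.trace_eq_sum_eigenvalues]
    simp
  rw [hdet, htr]
  have hle : ∀ i, Real.log (hM.1.eigenvalues i) ≤ hM.1.eigenvalues i - 1 := fun i =>
    Real.log_le_sub_one_of_pos (hM.eigenvalues_pos i)
  refine ⟨Finset.sum_le_sum fun i _ => hle i, fun hne => ?_⟩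
  refine Finset.sum_lt_sum (fun i _ => hle i) ?_
  by_contra! hcon
  have h1 : ∀ i, hM.1.eigenvalues i = 1 := fun i => by
    by_contra h
    exact absurd (Real.log_lt_sub_one_of_pos (hM.eigenvalues_pos i) h)
      (not_lt.2 (hcon i (Finset.mem_univ _)))
  apply hne
  rw [hM.1.spectral_theorem]
  have : (RCLike.ofReal ∘ hM.1.eigenvalues : ι → ℂ) = fun _ => 1 := by
    ext i
    simp [h1]
  rw [this, diagonal_one, map_one]

/-- The tangent inequality for the strictly concave function `log det`. -/
lemma PosDef.log_det_le_add_trace [DecidableEq ι] {K L : Matrix ι ι ℂ} (hK : K.PosDef) (hL : L.PosDef) :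
    Real.log L.det.re ≤ Real.log K.det.re + (K⁻¹ * (L - K)).trace.re ∧
    (L ≠ K → Real.log L.det.re < Real.log K.det.re + (K⁻¹ * (L - K)).trace.re) := by
  obtain ⟨C, hC⟩ := hK.posSemidef.exists_eq_conjTranspose_mul_self
  have hKu : IsUnit K.det := (isUnit_iff_isUnit_det _).1 hK.isUnit
  have hCu : IsUnit C.det := by
    rw [hC, det_mul] at hKu
    exact isUnit_of_mul_isUnit_right hKu
  have hCu' : IsUnit C := (isUnit_iff_isUnit_det _).2 hCu
  have hCH : IsUnit Cᴴ.det := by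
    rw [hC, det_mul] at hKu
    exact isUnit_of_mul_isUnit_left hKu
  -- Congruence by a factor of $K=C^HC$ moves the base point to the identity.
  set M := (C⁻¹)ᴴ * L * C⁻¹ with hMdef
  have hM : M.PosDef := by
    refine hL.conjTranspose_mul_mul_same ?_
    rw [mulVec_injective_iff_isUnit]
    exact (isUnit_nonsing_inv_iff).2 hCu'
  have hinv : K⁻¹ = C⁻¹ * (C⁻¹)ᴴ := by
    rw [hC, mul_inv_rev, conjTranspose_nonsing_inv]
  have htr : (M - 1).trace.re = (K⁻¹ * (L - K)).trace.re := by
    rw [mul_sub, nonsing_inv_mul _ hKu, trace_sub, trace_sub, hinv, hMdef,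
      mul_assoc (C⁻¹), trace_mul_comm (C⁻¹)]
  have hLM : L = Cᴴ * M * C := by
    rw [hMdef]
    calc L = (Cᴴ * (Cᴴ)⁻¹) * L * (C⁻¹ * C) := by
          rw [mul_nonsing_inv _ hCH, nonsing_inv_mul _ hCu, one_mul, mul_one]
      _ = _ := by rw [conjTranspose_nonsing_inv]; simp only [mul_assoc]
  have hdet : L.det = K.det * M.det := by
    rw [hLM, hC]; simp only [det_mul]; ring
  have hre : L.det.re = K.det.re * M.det.re := by
    have := (Complex.lt_def.1 hK.det_pos).2
    rw [hdet, Complex.mul_re]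
    simp at this
    rw [← this]
    simp
  have hKp : 0 < K.det.re := (Complex.lt_def.1 hK.det_pos).1
  have hMp : 0 < M.det.re := (Complex.lt_def.1 hM.det_pos).1
  rw [hre, Real.log_mul hKp.ne' hMp.ne', ← htr]
  refine ⟨by linarith [hM.log_det_le.1], fun hne => ?_⟩
  have : M ≠ 1 := fun h => hne (by rw [hLM, h, mul_one, ← hC])
  linarith [hM.log_det_le.2 this]

/-- The entries of a positive semidefinite matrix are bounded by its trace. -/
lemma PosSemidef.norm_apply_le_trace {A : Matrix ι ι ℂ} (hA : A.PosSemidef) (i j : ι) :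
    ‖A i j‖ ≤ A.trace.re := by
  obtain ⟨C, rfl⟩ := hA.exists_eq_conjTranspose_mul_self
  have h : ∀ k, 2 * ‖C k i‖ * ‖C k j‖ ≤ ‖C k i‖ ^ 2 + ‖C k j‖ ^ 2 := fun k => by
    nlinarith [sq_nonneg (‖C k i‖ - ‖C k j‖)]
  have hcol : ∀ l, ∑ k, ‖C k l‖ ^ 2 ≤ (Cᴴ * C).trace.re := fun l => by
    have e : (Cᴴ * C).trace.re = ∑ l, ∑ k, ‖C k l‖ ^ 2 := by
      simp only [trace, diag_apply, mul_apply, conjTranspose_apply, Complex.re_sum]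
      refine Finset.sum_congr rfl fun a _ => Finset.sum_congr rfl fun k _ => ?_
      rw [Complex.star_def, ← Complex.normSq_eq_conj_mul_self, Complex.ofReal_re,
        Complex.normSq_eq_norm_sq]
    rw [e]
    exact Finset.single_le_sum (f := fun l => ∑ k, ‖C k l‖ ^ 2)
      (fun l _ => Finset.sum_nonneg fun k _ => sq_nonneg _) (Finset.mem_univ l)
  calc ‖(Cᴴ * C) i j‖ ≤ ∑ k, ‖C k i‖ * ‖C k j‖ := by
        rw [mul_apply]
        refine (norm_sum_le _ _).trans (le_of_eq ?_)
        simp [conjTranspose_apply]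
    _ ≤ ∑ k, (‖C k i‖ ^ 2 + ‖C k j‖ ^ 2) / 2 :=
        Finset.sum_le_sum fun k _ => by linarith [h k]
    _ = ((∑ k, ‖C k i‖ ^ 2) + ∑ k, ‖C k j‖ ^ 2) / 2 := by
        rw [← Finset.sum_div, Finset.sum_add_distrib]
    _ ≤ _ := by linarith [hcol i, hcol j]

lemma isClosed_setOf_posSemidef : IsClosed {A : Matrix ι ι ℂ | A.PosSemidef} := by
  have : {A : Matrix ι ι ℂ | A.PosSemidef} =
      {A | Aᴴ = A} ∩ ⋂ x : ι → ℂ, {A | 0 ≤ star x ⬝ᵥ (A *ᵥ x)} := by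
    ext A
    simp [posSemidef_iff_dotProduct_mulVec, IsHermitian]
  rw [this]
  refine (isClosed_eq (by fun_prop) continuous_id).inter (isClosed_iInter fun x => ?_)
  exact isClosed_le continuous_const (by fun_prop)

lemma isCompact_posSemidef_trace_le (T : ℝ) :
    IsCompact {A : Matrix ι ι ℂ | A.PosSemidef ∧ A.trace.re ≤ T} := by
  have hK : IsCompact (Set.univ.pi fun _ : ι => Set.univ.pi fun _ : ι =>
      Metric.closedBall (0 : ℂ) T) :=
    isCompact_univ_pi fun _ => isCompact_univ_pi fun _ => isCompact_closedBall _ _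
  refine IsCompact.of_isClosed_subset hK ?_ ?_
  · exact isClosed_setOf_posSemidef.inter
      (isClosed_le (Complex.continuous_re.comp (by unfold trace diag; fun_prop)) continuous_const)
  · rintro A ⟨hA, hT⟩
    exact fun i _ j _ => mem_closedBall_zero_iff.2 ((hA.norm_apply_le_trace i j).trans hT)

end Matrix

/-! ### A single user: energy efficiency, its maximizers, and water-filling. -/

noncomputable section

namespace Matrix

lemma PosSemidef.convexComb {ι : Type*} {X Z : Matrix ι ι ℂ} (hX : X.PosSemidef) (hZ : Z.PosSemidef) {θ : ℝ}
    (h0 : 0 ≤ θ) (h1 : θ ≤ 1) : ((1 - θ) • X + θ • Z).PosSemidef :=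
  (hX.smul (sub_nonneg.2 h1)).add (hZ.smul h0)

variable {ι : Type*} [Fintype ι]

/-- If `μ ≤ K` with `0 < μ`, then `K⁻¹ ≤ μ⁻¹`, tested against a positive semidefinite matrix. -/
lemma PosDef.trace_inv_mul_le [DecidableEq ι] {K Z : Matrix ι ι ℂ} (hK : K.PosDef) {μ : ℝ} (hμ : 0 < μ)
    (hN : (K - (μ : ℂ) • (1 : Matrix ι ι ℂ)).PosSemidef) (hZ : Z.PosSemidef) :
    (K⁻¹ * Z).trace.re ≤ μ⁻¹ * Z.trace.re := by
  have hKu : IsUnit K.det := (isUnit_iff_isUnit_det _).1 hK.isUnit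
  set N := K - (μ : ℂ) • (1 : Matrix ι ι ℂ) with hNdef
  have hμ' : (μ : ℂ) ≠ 0 := by exact_mod_cast hμ.ne'
  have hKN : K = N + (μ : ℂ) • (1 : Matrix ι ι ℂ) := by rw [hNdef, sub_add_cancel]
  -- The middle factor is $\mu^{-1}N^2+N=K(\mu^{-1}K-1)$, visibly positive semidefinite.
  have e : ((μ⁻¹ : ℝ) : ℂ) • (1 : Matrix ι ι ℂ) - K⁻¹ =
      K⁻¹ * (((μ⁻¹ : ℝ) : ℂ) • (Nᴴ * N) + N) * (K⁻¹)ᴴ := by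
    rw [hK.inv.isHermitian.eq, hN.isHermitian.eq]
    have h1 : ((μ⁻¹ : ℝ) : ℂ) • (N * N) + N = K * (((μ⁻¹ : ℝ) : ℂ) • K - 1) := by
      rw [hKN]
      simp only [smul_add, smul_smul, add_mul, mul_sub, mul_add, Matrix.mul_smul, Matrix.smul_mul,
        mul_one, one_mul]
      push_cast
      rw [inv_mul_cancel₀ hμ']
      simp
    rw [h1, nonsing_inv_mul_cancel_left _ _ hKu, sub_mul, Matrix.smul_mul, mul_nonsing_inv _ hKu,
      one_mul]
  have hpsd : (((μ⁻¹ : ℝ) : ℂ) • (1 : Matrix ι ι ℂ) - K⁻¹).PosSemidef := by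
    rw [e]
    refine PosSemidef.mul_mul_conjTranspose_same (PosSemidef.add ?_ hN) _
    refine (posSemidef_conjTranspose_mul_self N).smul ?_
    exact_mod_cast (inv_pos.2 hμ).le
  have := hpsd.trace_mul_re_nonneg hZ
  rw [sub_mul, Matrix.smul_mul, one_mul, trace_sub, trace_smul, Complex.sub_re, smul_eq_mul,
    Complex.re_ofReal_mul] at this
  linarith

lemma trace_convexComb_re (X Z : Matrix ι ι ℂ) (θ : ℝ) :
    ((1 - θ) • X + θ • Z).trace.re = (1 - θ) * X.trace.re + θ * Z.trace.re := by
  simp [trace_add, trace_smul]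

lemma trace_mul_vecMulVec_star (A : Matrix ι ι ℂ) (v : ι → ℂ) :
    (A * vecMulVec v (star v)).trace = star v ⬝ᵥ (A *ᵥ v) := by
  rw [mul_vecMulVec, trace_vecMulVec, dotProduct_comm]

variable [DecidableEq ι]

/-- The rate `log det (I + W⁻¹ X)` of a single user with effective noise covariance `W`. -/
def effRate (W X : Matrix ι ι ℂ) : ℝ := Real.log (1 + W⁻¹ * X).det.re

/-- The energy efficiency of a single user with effective noise covariance `W`. -/
def effEE (W : Matrix ι ι ℂ) (ψ : ℝ) (X : Matrix ι ι ℂ) : ℝ := effRate W X / (ψ + X.trace.re)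

section

variable {W X Z : Matrix ι ι ℂ} {ψ : ℝ}

lemma effRate_eq (hW : W.PosDef) (hX : X.PosSemidef) :
    effRate W X = Real.log (W + X).det.re - Real.log W.det.re := by
  have hWu : IsUnit W.det := (isUnit_iff_isUnit_det _).1 hW.isUnit
  have hdet : (W + X).det = W.det * (1 + W⁻¹ * X).det := by
    rw [← det_mul, mul_add, mul_one, mul_nonsing_inv_cancel_left _ _ hWu]
  have hWp := Complex.lt_def.1 hW.det_pos
  have hWXp := Complex.lt_def.1 (hW.add_posSemidef hX).det_pos
  have hre : (W + X).det.re = W.det.re * (1 + W⁻¹ * X).det.re := by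
    rw [hdet, Complex.mul_re, ← hWp.2]
    simp
  have hp : 0 < (1 + W⁻¹ * X).det.re := by
    have := hWXp.1
    rw [hre] at this
    exact pos_of_mul_pos_right this hWp.1.le
  rw [hre, Real.log_mul (ne_of_gt hWp.1) hp.ne', effRate]
  ring

@[simp] lemma effRate_zero : effRate W 0 = 0 := by simp [effRate]

lemma effRate_le (hW : W.PosDef) (hX : X.PosSemidef) (hZ : Z.PosSemidef) :
    effRate W Z ≤ effRate W X + ((W + X)⁻¹ * (Z - X)).trace.re := by
  have := ((hW.add_posSemidef hX).log_det_le_add_trace (hW.add_posSemidef hZ)).1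
  rw [effRate_eq hW hX, effRate_eq hW hZ]
  rw [add_sub_add_left_eq_sub] at this
  linarith

lemma effRate_lt (hW : W.PosDef) (hX : X.PosSemidef) (hZ : Z.PosSemidef) (h : Z ≠ X) :
    effRate W Z < effRate W X + ((W + X)⁻¹ * (Z - X)).trace.re := by
  have := ((hW.add_posSemidef hX).log_det_le_add_trace (hW.add_posSemidef hZ)).2 (by simpa)
  rw [effRate_eq hW hX, effRate_eq hW hZ]
  rw [add_sub_add_left_eq_sub] at this
  linarith

lemma effRate_pos (hW : W.PosDef) (hX : X.PosSemidef) (h : X ≠ 0) : 0 < effRate W X := by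
  have h1 := effRate_lt hW hX PosSemidef.zero h.symm
  have h2 := (hW.add_posSemidef hX).inv.posSemidef.trace_mul_re_nonneg hX
  rw [zero_sub, mul_neg, trace_neg, Complex.neg_re, effRate_zero] at h1
  linarith

lemma effRate_nonneg (hW : W.PosDef) (hX : X.PosSemidef) : 0 ≤ effRate W X := by
  rcases eq_or_ne X 0 with rfl | h
  · simp
  · exact (effRate_pos hW hX h).le

lemma effRate_strictConcave (hW : W.PosDef) (hX : X.PosSemidef) (hZ : Z.PosSemidef) (h : X ≠ Z)
    {θ : ℝ} (h0 : 0 < θ) (h1 : θ < 1) :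
    (1 - θ) * effRate W X + θ * effRate W Z < effRate W ((1 - θ) • X + θ • Z) := by
  set Y := (1 - θ) • X + θ • Z with hY
  have hYp : Y.PosSemidef := hX.convexComb hZ h0.le h1.le
  have eX : X - Y = θ • (X - Z) := by rw [hY]; module
  have eZ : Z - Y = (-(1 - θ)) • (X - Z) := by rw [hY]; module
  have hXY : X ≠ Y := by
    rw [← sub_ne_zero, eX]
    exact smul_ne_zero h0.ne' (sub_ne_zero.2 h)
  have a := effRate_lt hW hYp hX hXY
  have b := effRate_le hW hYp hZ
  rw [eX, Matrix.mul_smul, trace_smul, Complex.smul_re, smul_eq_mul] at a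
  rw [eZ, Matrix.mul_smul, trace_smul, Complex.smul_re, smul_eq_mul] at b
  nlinarith

/-- With $e$ the value at $X$, both points satisfy rate $\ge e(\psi+\operatorname{Tr})$. The right
side is affine and the rate strictly concave, so the inequality is strict in between. -/
lemma effEE_quasiconcave (hW : W.PosDef) (hψ : 0 < ψ) (hX : X.PosSemidef) (hZ : Z.PosSemidef)
    (h : X ≠ Z) (hle : effEE W ψ X ≤ effEE W ψ Z) {θ : ℝ} (h0 : 0 < θ) (h1 : θ < 1) :
    effEE W ψ X < effEE W ψ ((1 - θ) • X + θ • Z) := by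
  have hdX : 0 < ψ + X.trace.re := by linarith [hX.trace_re_nonneg]
  have hdZ : 0 < ψ + Z.trace.re := by linarith [hZ.trace_re_nonneg]
  have hdY := (hX.convexComb hZ h0.le h1.le).trace_re_nonneg
  have hc := effRate_strictConcave hW hX hZ h h0 h1
  rw [trace_convexComb_re] at hdY
  change _ < effRate W _ / _
  rw [trace_convexComb_re, lt_div_iff₀ (by linarith)]
  have eX : effRate W X = effEE W ψ X * (ψ + X.trace.re) := (div_mul_cancel₀ _ hdX.ne').symm
  have eZ : effEE W ψ X * (ψ + Z.trace.re) ≤ effRate W Z := by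
    exact (le_div_iff₀ hdZ).1 hle
  nlinarith

lemma effEE_maximizer_unique (hW : W.PosDef) (hψ : 0 < ψ) {T : Set ℝ} (hT : Convex ℝ T)
    (hX : X.PosSemidef) (hXT : X.trace.re ∈ T)
    (hXmax : ∀ Y : Matrix ι ι ℂ, Y.PosSemidef → Y.trace.re ∈ T → effEE W ψ Y ≤ effEE W ψ X)
    (hZ : Z.PosSemidef) (hZT : Z.trace.re ∈ T) (hle : effEE W ψ X ≤ effEE W ψ Z) : X = Z := by
  by_contra h
  have h1 := effEE_quasiconcave hW hψ hX hZ h hle (θ := 1 / 2) (by norm_num) (by norm_num)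
  refine absurd (hXmax _ (hX.convexComb hZ (by norm_num) (by norm_num)) ?_) (not_le.2 h1)
  rw [trace_convexComb_re]
  exact hT hXT hZT (by norm_num) (by norm_num) (by norm_num)

lemma continuousOn_effEE (hW : W.PosDef) (hψ : 0 < ψ) :
    ContinuousOn (effEE W ψ) {X | X.PosSemidef} := by
  have h : ContinuousOn (fun X => (Real.log (W + X).det.re - Real.log W.det.re) /
      (ψ + X.trace.re)) {X : Matrix ι ι ℂ | X.PosSemidef} := by
    refine ContinuousOn.div (ContinuousOn.sub (ContinuousOn.log ?_ ?_) continuousOn_const) ?_ ?_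
    · exact Continuous.continuousOn
        (Complex.continuous_re.comp (continuous_const.add continuous_id).matrix_det)
    · exact fun X hX => ne_of_gt (Complex.lt_def.1 (hW.add_posSemidef hX).det_pos).1
    · exact Continuous.continuousOn
        (continuous_const.add (Complex.continuous_re.comp continuous_id.matrix_trace))
    · intro X hX
      have := PosSemidef.trace_re_nonneg hX
      positivity
  refine h.congr fun X hX => ?_
  rw [effEE, effRate_eq hW hX]

lemma exists_effEE_max_of_trace_le (hW : W.PosDef) (hψ : 0 < ψ) {P : ℝ} (hP : 0 ≤ P) :
    ∃ X : Matrix ι ι ℂ, X.PosSemidef ∧ X.trace.re ≤ P ∧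
      ∀ Z : Matrix ι ι ℂ, Z.PosSemidef → Z.trace.re ≤ P → effEE W ψ Z ≤ effEE W ψ X := by
  obtain ⟨X, hX, hmax⟩ := (isCompact_posSemidef_trace_le (ι := ι) P).exists_isMaxOn
    ⟨0, PosSemidef.zero, by simpa⟩ ((continuousOn_effEE hW hψ).mono fun X hX => hX.1)
  exact ⟨X, hX.1, hX.2, fun Z hZ hZP => hmax ⟨hZ, hZP⟩⟩

/-- The tangent at $\varepsilon^{-1}I$ has slope $(W+\varepsilon^{-1}I)^{-1}\le\varepsilon I$. Since
$\varepsilon$ is arbitrary, the rate grows sublinearly in the power. -/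
lemma effRate_le_linear (hW : W.PosDef) (hX : X.PosSemidef) {ε : ℝ} (hε : 0 < ε) :
    effRate W X ≤ effRate W ((ε⁻¹ : ℝ) • 1) + ε * X.trace.re := by
  have hI : ((ε⁻¹ : ℝ) • (1 : Matrix ι ι ℂ)).PosSemidef :=
    PosSemidef.one.smul (inv_nonneg.2 hε.le)
  have hK := hW.add_posSemidef hI
  have h1 := effRate_le hW hI hX
  have h2 := hK.inv.posSemidef.trace_mul_re_nonneg hI
  have h3 := hK.trace_inv_mul_le (inv_pos.2 hε) (Z := X) (by
    have : W + (ε⁻¹ : ℝ) • (1 : Matrix ι ι ℂ) - ((ε⁻¹ : ℝ) : ℂ) • (1 : Matrix ι ι ℂ) = W := by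
      rw [Complex.coe_smul, add_sub_cancel_right]
    rw [this]
    exact hW.posSemidef) hX
  rw [mul_sub, trace_sub, Complex.sub_re] at h1
  rw [inv_inv] at h3
  linarith

lemma exists_effEE_max [Nonempty ι] (hW : W.PosDef) (hψ : 0 < ψ) :
    ∃ X : Matrix ι ι ℂ, X.PosSemidef ∧
      ∀ Z : Matrix ι ι ℂ, Z.PosSemidef → effEE W ψ Z ≤ effEE W ψ X := by
  set e := effEE W ψ 1 with he
  have hI : (1 : Matrix ι ι ℂ).PosSemidef := PosSemidef.one
  have he0 : 0 < e := div_pos (effRate_pos hW hI one_ne_zero)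
    (by linarith [hI.trace_re_nonneg])
  set C := effRate W (((e / 2)⁻¹ : ℝ) • 1) with hC
  -- Coercivity: $e(\psi+\operatorname{Tr}X)\le C+\tfrac e2\operatorname{Tr}X$ bounds the trace of
  -- everything at least as good as the identity.
  have key : ∀ X : Matrix ι ι ℂ, X.PosSemidef → e ≤ effEE W ψ X → X.trace.re ≤ C / (e / 2) := by
    intro X hX h
    have hd : 0 < ψ + X.trace.re := by linarith [hX.trace_re_nonneg]
    rw [effEE, le_div_iff₀ hd] at h
    have := effRate_le_linear hW hX (half_pos he0)
    rw [le_div_iff₀ (half_pos he0)]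
    nlinarith
  have h1 := key 1 hI he.le
  obtain ⟨X, hX, -, hmax⟩ := exists_effEE_max_of_trace_le hW hψ (hI.trace_re_nonneg.trans h1)
  refine ⟨X, hX, fun Z hZ => ?_⟩
  rcases le_total e (effEE W ψ Z) with h | h
  · exact hmax Z hZ (key Z hZ h)
  · exact h.trans (hmax 1 hI h1)

/-- A water-filling solution: `X` solves the variational inequality of the convex set of positive
semidefinite matrices of given trace `p` and the map `X ↦ W + X`. -/
def IsWaterfilling (W : Matrix ι ι ℂ) (p : ℝ) (X : Matrix ι ι ℂ) : Prop :=
  X.PosSemidef ∧ X.trace.re = p ∧ ∀ Z : Matrix ι ι ℂ, Z.PosSemidef → Z.trace.re = p →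
    0 ≤ ((W + X) * (Z - X)).trace.re

/-- Testing the inequality against $p\,vv^H$, with $v$ a unit eigenvector for the least eigenvalue
$\mu$ of $W+X$, gives $\operatorname{Tr}((W+X-\mu)X)\le0$. Complementary slackness follows; $\mu$ is
the water level. -/
lemma IsWaterfilling.exists_waterLevel [Nonempty ι] {p : ℝ} (hW : W.PosDef)
    (h : IsWaterfilling W p X) :
    ∃ (μ : ℝ) (v : ι → ℂ), 0 < μ ∧ star v ⬝ᵥ v = 1 ∧ (W + X) *ᵥ v = (μ : ℂ) • v ∧
      (W + X - (μ : ℂ) • (1 : Matrix ι ι ℂ)).PosSemidef ∧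
      (W + X - (μ : ℂ) • (1 : Matrix ι ι ℂ)) * X = 0 := by
  obtain ⟨hX, hp, hVI⟩ := h
  have hK := hW.add_posSemidef hX
  obtain ⟨μ, v, hv, hKv, hN⟩ := hK.isHermitian.exists_least_eigenvector
  have hμ : star v ⬝ᵥ ((W + X) *ᵥ v) = μ := by
    rw [hKv, dotProduct_smul, hv, smul_eq_mul, mul_one]
  have hv0 : v ≠ 0 := by rintro rfl; simp at hv
  refine ⟨μ, v, ?_, hv, hKv, hN, ?_⟩
  · have := hK.dotProduct_mulVec_pos hv0
    rw [hμ] at this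
    exact_mod_cast this
  · apply hN.mul_eq_zero_of_trace_re hX
    have hp0 : 0 ≤ p := hp ▸ hX.trace_re_nonneg
    have htr : (p • vecMulVec v (star v)).trace.re = p := by
      rw [trace_smul, trace_vecMulVec, dotProduct_comm, hv]
      simp
    have := hVI (p • vecMulVec v (star v)) ((posSemidef_vecMulVec_self_star v).smul hp0) htr
    rw [mul_sub, trace_sub, Complex.sub_re, Matrix.mul_smul, trace_smul, trace_mul_vecMulVec_star, hμ,
      Complex.smul_re, Complex.ofReal_re, smul_eq_mul] at this
    rw [sub_mul, trace_sub, Matrix.smul_mul, one_mul, trace_smul, Complex.sub_re, smul_eq_mul,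
      Complex.re_ofReal_mul, hp]
    linarith

/-- The inequality is stated for $W+X$, whereas the rate has gradient $(W+X)^{-1}$. The water level
bridges the two: $(W+X)^{-1}\le\mu^{-1}$, with equality on the range of $X$, so the tangent at $X$
does not increase along the slice. -/
lemma IsWaterfilling.effRate_le [Nonempty ι] {p : ℝ} (hW : W.PosDef) (h : IsWaterfilling W p X)
    (hZ : Z.PosSemidef) (hZp : Z.trace.re = p) : effRate W Z ≤ effRate W X := by
  obtain ⟨μ, v, hμ, -, -, hN, hNX⟩ := h.exists_waterLevel hW
  obtain ⟨hX, hp, -⟩ := h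
  have hK := hW.add_posSemidef hX
  have hKu : IsUnit (W + X).det := (isUnit_iff_isUnit_det _).1 hK.isUnit
  have h1 := hK.trace_inv_mul_le hμ hN hZ
  have h2 : ((W + X)⁻¹ * X).trace.re = μ⁻¹ * p := by
    rw [sub_mul, Matrix.smul_mul, one_mul, sub_eq_zero] at hNX
    have : X = (μ : ℂ) • ((W + X)⁻¹ * X) := by
      rw [← Matrix.mul_smul, ← hNX, nonsing_inv_mul_cancel_left _ _ hKu]
    have h3 := congrArg (fun A : Matrix ι ι ℂ => A.trace.re) this
    simp only [trace_smul, smul_eq_mul, Complex.re_ofReal_mul, hp] at h3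
    rw [h3, inv_mul_cancel_left₀ hμ.ne']
  have h3 := Matrix.effRate_le hW hX hZ
  rw [mul_sub, trace_sub, Complex.sub_re, h2] at h3
  rw [hZp] at h1
  linarith

/-- The best response of a single user is the water-filling solution whose power is the minimum of
the maximum power and of the power of the unconstrained maximizer. -/
lemma effEE_bestResponse_iff [Nonempty ι] (hW : W.PosDef) (hψ : 0 < ψ) {P : ℝ} (hP : 0 ≤ P)
    (hex : ∀ p : ℝ, 0 ≤ p → ∃ X, IsWaterfilling W p X) {Xu : Matrix ι ι ℂ} (hXu : Xu.PosSemidef)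
    (hmax : ∀ Z : Matrix ι ι ℂ, Z.PosSemidef → effEE W ψ Z ≤ effEE W ψ Xu) :
    ((X.PosSemidef ∧ X.trace.re ≤ P) ∧
      ∀ Z : Matrix ι ι ℂ, Z.PosSemidef → Z.trace.re ≤ P → effEE W ψ Z ≤ effEE W ψ X) ↔
    IsWaterfilling W (min P Xu.trace.re) X := by
  -- A constrained maximizer is the unconstrained one if that is affordable. Otherwise it uses all
  -- the power, since moving towards `Xu` strictly increases the EE.
  have htr : ∀ X : Matrix ι ι ℂ, X.PosSemidef → X.trace.re ≤ P →
      (∀ Z : Matrix ι ι ℂ, Z.PosSemidef → Z.trace.re ≤ P → effEE W ψ Z ≤ effEE W ψ X) →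
      X.trace.re = min P Xu.trace.re := by
    intro X hX hXP hXmax
    rcases le_or_gt Xu.trace.re P with hle | hlt
    · have : Xu = X := effEE_maximizer_unique hW hψ (convex_univ) hXu (Set.mem_univ _)
        (fun Z hZ _ => hmax Z hZ) hX (Set.mem_univ _) (hXmax Xu hXu hle)
      rw [← this, min_eq_right hle]
    · rw [min_eq_left hlt.le]
      by_contra hne
      have hXP' : X.trace.re < P := lt_of_le_of_ne hXP hne
      have hd : 0 < Xu.trace.re - X.trace.re := by linarith
      have hne' : X ≠ Xu := by rintro rfl; linarith
      -- The point of the segment from `X` to `Xu` whose trace is exactly `P`.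
      set θ := (P - X.trace.re) / (Xu.trace.re - X.trace.re) with hθ
      have h0 : 0 < θ := div_pos (by linarith) hd
      have h1 : θ < 1 := by rw [hθ, div_lt_one hd]; linarith
      have h2 : θ * (Xu.trace.re - X.trace.re) = P - X.trace.re := div_mul_cancel₀ _ hd.ne'
      refine absurd (hXmax _ (hX.convexComb hXu h0.le h1.le) ?_) (not_le.2
        (effEE_quasiconcave hW hψ hX hXu hne' (hmax X hX) h0 h1))
      rw [trace_convexComb_re]
      linarith
  have hWF : ∀ X, IsWaterfilling W (min P Xu.trace.re) X →
      ∀ Z : Matrix ι ι ℂ, Z.PosSemidef → Z.trace.re ≤ P → effEE W ψ Z ≤ effEE W ψ X := by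
    intro X hX
    obtain ⟨X₀, h₀, h₀P, h₀max⟩ := exists_effEE_max_of_trace_le hW hψ hP
    have h1 := htr X₀ h₀ h₀P h₀max
    have h2 := hX.effRate_le hW h₀ h1
    have h3 : effEE W ψ X₀ ≤ effEE W ψ X := by
      rw [effEE, effEE, h1, hX.2.1]
      refine div_le_div_of_nonneg_right h2 ?_
      have := le_min hP hXu.trace_re_nonneg
      linarith
    exact fun Z hZ hZP => (h₀max Z hZ hZP).trans h3
  constructor
  · rintro ⟨⟨hX, hXP⟩, hXmax⟩
    obtain ⟨X₁, h₁⟩ := hex (min P Xu.trace.re) (le_min hP hXu.trace_re_nonneg)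
    have h₁P : X₁.trace.re ≤ P := h₁.2.1.trans_le (min_le_left _ _)
    have : X = X₁ := effEE_maximizer_unique hW hψ (convex_Iic P) hX hXP hXmax h₁.1 h₁P
      (hWF X₁ h₁ X hX hXP)
    rwa [this]
  · exact fun h => ⟨⟨h.1, h.2.1.trans_le (min_le_left _ _)⟩, hWF X h⟩

end

end Matrix

end

/-! ### Variational inequalities and the Frobenius Hilbert space of profiles. -/

noncomputable section

open scoped RealInnerProductSpace in
/-- A strongly monotone Lipschitz map has a solution of the variational inequality on every nonempty
complete convex set. -/
theorem exists_variationalInequality_solution {E : Type*} [NormedAddCommGroup E]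
    [InnerProductSpace ℝ E] {K : Set E} (hne : K.Nonempty) (hK : IsComplete K) (hconv : Convex ℝ K)
    (F : E → E) {c L : ℝ} (hc : 0 < c)
    (hmono : ∀ x y, c * ‖x - y‖ ^ 2 ≤ ⟪F x - F y, x - y⟫)
    (hlip : ∀ x y, ‖F x - F y‖ ≤ L * ‖x - y‖) :
    ∃ x ∈ K, ∀ z ∈ K, 0 ≤ ⟪F x, z - x⟫ := by
  have hproj : ∀ u : E, ∃ v ∈ K, ∀ w ∈ K, ⟪u - v, w - v⟫ ≤ 0 := fun u => by
    obtain ⟨v, hv, h⟩ := exists_norm_eq_iInf_of_complete_convex hne hK hconv u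
    exact ⟨v, hv, (norm_eq_iInf_iff_real_inner_le_zero hconv hv).1 h⟩
  choose P hPK hP using hproj
  have hP1 : ∀ u v, ‖P u - P v‖ ≤ ‖u - v‖ := by
    intro u v
    have h1 := hP u (P v) (hPK v)
    have h2 := hP v (P u) (hPK u)
    have h3 : ‖P u - P v‖ ^ 2 ≤ ⟪u - v, P u - P v⟫ := by
      rw [← real_inner_self_eq_norm_sq]
      simp only [inner_sub_left, inner_sub_right] at *
      linarith
    have h4 := real_inner_le_norm (u - v) (P u - P v)
    by_contra! h
    nlinarith [norm_nonneg (u - v)]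
  -- The maximum guarantees $0<M$ and $c\le M$. The step $\gamma=c/M^2$ minimizes $1-2\gamma
  -- c+\gamma^2M^2$, leaving the squared contraction factor $1-c^2/M^2$.
  set M := max L c with hM
  have hM0 : 0 < M := hc.trans_le (le_max_right _ _)
  set γ := c / M ^ 2 with hγ
  have hγ0 : 0 < γ := by positivity
  set k := Real.sqrt (1 - c ^ 2 / M ^ 2) with hk
  have hk0 : 0 ≤ 1 - c ^ 2 / M ^ 2 := by
    rw [sub_nonneg, div_le_one (by positivity)]
    exact pow_le_pow_left₀ hc.le (le_max_right _ _) 2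
  have hk1 : k < 1 := by
    rw [hk, Real.sqrt_lt' one_pos]
    have : 0 < c ^ 2 / M ^ 2 := by positivity
    linarith
  set T : E → E := fun x => P (x - γ • F x) with hT
  have hTlip : ∀ x y, ‖T x - T y‖ ≤ k * ‖x - y‖ := by
    intro x y
    refine (hP1 _ _).trans (le_of_sq_le_sq ?_ (by positivity))
    have e : x - γ • F x - (y - γ • F y) = (x - y) - γ • (F x - F y) := by
      rw [smul_sub]; abel
    rw [e, norm_sub_sq_real, inner_smul_right, norm_smul, mul_pow, mul_pow, hk, Real.sq_sqrt hk0,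
      real_inner_comm, Real.norm_eq_abs, sq_abs]
    have h1 := hmono x y
    have h2 : ‖F x - F y‖ ^ 2 ≤ M ^ 2 * ‖x - y‖ ^ 2 := by
      rw [← mul_pow]
      refine pow_le_pow_left₀ (norm_nonneg _) ((hlip x y).trans ?_) 2
      exact mul_le_mul_of_nonneg_right (le_max_left _ _) (norm_nonneg _)
    have h3 : γ ^ 2 * (M ^ 2 * ‖x - y‖ ^ 2) = c ^ 2 / M ^ 2 * ‖x - y‖ ^ 2 := by
      rw [hγ]; field_simp
    have h4 : γ * (c * ‖x - y‖ ^ 2) = c ^ 2 / M ^ 2 * ‖x - y‖ ^ 2 := by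
      rw [hγ]; field_simp
    have h5 := mul_le_mul_of_nonneg_left h1 hγ0.le
    have h6 := mul_le_mul_of_nonneg_left h2 (sq_nonneg γ)
    linarith
  have hmaps : Set.MapsTo T K K := fun x _ => hPK _
  have hcontr : ContractingWith k.toNNReal (hmaps.restrict T K K) := by
    refine ⟨by simpa using hk1, LipschitzWith.of_dist_le_mul fun x y => ?_⟩
    rw [Subtype.dist_eq, Subtype.dist_eq, dist_eq_norm, dist_eq_norm,
      Real.coe_toNNReal _ (Real.sqrt_nonneg _)]
    exact hTlip x y
  obtain ⟨x₀, hx₀⟩ := hne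
  obtain ⟨x, hx, hfix, -⟩ := hcontr.exists_fixedPoint' hK hmaps hx₀ (edist_ne_top _ _)
  refine ⟨x, hx, fun z hz => ?_⟩
  have h1 := hP (x - γ • F x) z hz
  have h2 : P (x - γ • F x) = x := hfix
  rw [h2, sub_sub_cancel_left, inner_neg_left, inner_smul_left] at h1
  simp only [conj_trivial] at h1
  by_contra! h
  nlinarith

namespace Matrix

variable {m n : Type*} [Fintype m] [Fintype n]

/-- A matrix as a vector of the Euclidean space, so that the norm is the Frobenius norm. -/
def frobVec : Matrix m n ℂ ≃ₗ[ℝ] EuclideanSpace ℂ (m × n) where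
  toFun A := WithLp.toLp 2 fun p => A p.1 p.2
  invFun x := Matrix.of fun i j => x (i, j)
  map_add' _ _ := rfl
  map_smul' _ _ := rfl
  left_inv _ := rfl
  right_inv _ := rfl

lemma frobVec_norm_sq (A : Matrix m n ℂ) : ‖frobVec A‖ ^ 2 = ∑ i, ∑ j, ‖A i j‖ ^ 2 := by
  rw [EuclideanSpace.norm_sq_eq, Fintype.sum_prod_type]
  rfl

lemma frobVec_inner (A B : Matrix m n ℂ) :
    inner ℝ (frobVec A) (frobVec B) = (Aᴴ * B).trace.re := by
  rw [PiLp.inner_apply, Fintype.sum_prod_type, Finset.sum_comm]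
  simp only [trace, diag_apply, mul_apply, conjTranspose_apply, Complex.re_sum]
  refine Finset.sum_congr rfl fun i _ => Finset.sum_congr rfl fun j _ => ?_
  rw [Complex.inner, mul_comm]
  rfl

end Matrix

open Matrix

variable {Q : ℕ} {n : Fin Q → ℕ}

/-- A profile as a vector of a Hilbert space whose norm is the Frobenius norm. -/
def profileVec : Profile n ≃ₗ[ℝ]
    PiLp 2 (fun q : Fin Q => EuclideanSpace ℂ (Fin (n q) × Fin (n q))) where
  toFun X := WithLp.toLp 2 fun q => frobVec (X q)
  invFun x := fun q => frobVec.symm (x q)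
  map_add' X Y := by ext q : 1; simp
  map_smul' a X := by ext q : 1; simp
  left_inv X := by funext q; simp
  right_inv x := by ext q : 1; simp

@[simp] lemma profileVec_apply (X : Profile n) (q : Fin Q) : profileVec X q = frobVec (X q) := rfl

lemma profileVec_norm (X : Profile n) : ‖profileVec X‖ = profileNorm X := by
  rw [PiLp.norm_eq_of_L2, profileNorm]
  simp only [profileVec_apply, frobVec_norm_sq]

lemma profileVec_inner (X Y : Profile n) :
    inner ℝ (profileVec X) (profileVec Y) = ∑ q, ((X q)ᴴ * Y q).trace.re := by
  rw [PiLp.inner_apply]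
  simp only [profileVec_apply, frobVec_inner]

/-- The profiles of positive semidefinite matrices with prescribed traces. -/
def powerSlice (n : Fin Q → ℕ) (p : Fin Q → ℝ) : Set (Profile n) :=
  {X | ∀ q, (X q).PosSemidef ∧ (X q).trace.re = p q}

lemma powerSlice_nonempty (hn : ∀ q, 0 < n q) {p : Fin Q → ℝ} (hp : ∀ q, 0 ≤ p q) :
    (powerSlice n p).Nonempty := by
  refine ⟨fun q => (p q / n q : ℝ) • (1 : Matrix (Fin (n q)) (Fin (n q)) ℂ), fun q => ⟨?_, ?_⟩⟩
  · exact PosSemidef.one.smul (div_nonneg (hp q) (Nat.cast_nonneg _))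
  · have : (n q : ℝ) ≠ 0 := by exact_mod_cast (hn q).ne'
    simp [trace_smul, div_mul_cancel₀ _ this]

lemma convex_powerSlice (p : Fin Q → ℝ) : Convex ℝ (powerSlice n p) := by
  intro X hX Y hY a b ha hb hab q
  refine ⟨((hX q).1.smul ha).add ((hY q).1.smul hb), ?_⟩
  simp [trace_add, trace_smul, (hX q).2, (hY q).2, ← add_mul, hab]

lemma isClosed_powerSlice (p : Fin Q → ℝ) : IsClosed (powerSlice n p) := by
  have : powerSlice n p = ⋂ q, ({X : Profile n | (X q).PosSemidef} ∩
      {X : Profile n | (X q).trace.re = p q}) := by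
    ext X
    simp [powerSlice]
  rw [this]
  refine isClosed_iInter fun q => IsClosed.inter ?_ ?_
  · exact IsClosed.preimage (f := fun X : Profile n => X q) (continuous_apply q)
      isClosed_setOf_posSemidef
  · exact isClosed_eq (Complex.continuous_re.comp (continuous_apply q).matrix_trace)
      continuous_const

/-- Solvability, player by player, of the variational inequality on a power slice. -/
lemma exists_powerSlice_solution (hn : ∀ q, 0 < n q) {p : Fin Q → ℝ} (hp : ∀ q, 0 ≤ p q)
    (F : Profile n → Profile n) {c L : ℝ} (hc : 0 < c)
    (hmono : ∀ X Y, c * profileNorm (X - Y) ^ 2 ≤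
      ∑ q, ((F X q - F Y q)ᴴ * (X q - Y q)).trace.re)
    (hlip : ∀ X Y, profileNorm (F X - F Y) ≤ L * profileNorm (X - Y)) :
    ∃ X ∈ powerSlice n p, ∀ q, ∀ Z : Matrix (Fin (n q)) (Fin (n q)) ℂ, Z.PosSemidef →
      Z.trace.re = p q → 0 ≤ ((F X q)ᴴ * (Z - X q)).trace.re := by
  have hcont : Continuous (profileVec (n := n)).symm :=
    (profileVec (n := n)).symm.toLinearMap.continuous_of_finiteDimensional
  obtain ⟨x, hx, hVI⟩ := exists_variationalInequality_solution
    (K := (profileVec (n := n)).symm ⁻¹' powerSlice n p)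
    (by
      obtain ⟨X, hX⟩ := powerSlice_nonempty hn hp
      exact ⟨profileVec X, by simpa using hX⟩)
    ((isClosed_powerSlice p).preimage hcont).isComplete
    ((convex_powerSlice p).linear_preimage (profileVec (n := n)).symm.toLinearMap)
    (fun x => profileVec (F (profileVec.symm x))) hc
    (fun x y => by
      obtain ⟨X, rfl⟩ := profileVec.surjective x
      obtain ⟨Y, rfl⟩ := profileVec.surjective y
      simpa only [LinearEquiv.symm_apply_apply, ← map_sub, profileVec_norm, profileVec_inner, Pi.sub_apply]
        using hmono X Y)
    (fun x y => by
      obtain ⟨X, rfl⟩ := profileVec.surjective x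
      obtain ⟨Y, rfl⟩ := profileVec.surjective y
      simpa only [LinearEquiv.symm_apply_apply, ← map_sub, profileVec_norm] using hlip X Y)
  obtain ⟨X, rfl⟩ := profileVec.surjective x
  simp only [Set.mem_preimage, LinearEquiv.symm_apply_apply] at hx hVI
  refine ⟨X, hx, fun q Z hZ hZp => ?_⟩
  -- The slice is a product over the players: changing a single component isolates one term of the
  -- sum.
  have h1 := hVI (profileVec (Function.update X q Z)) (by
    simp only [LinearEquiv.symm_apply_apply]
    intro r
    rcases eq_or_ne r q with rfl | hr
    · simpa using ⟨hZ, hZp⟩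
    · simpa [hr] using hx r)
  rw [← map_sub, profileVec_inner, Finset.sum_eq_single q] at h1
  · simpa using h1
  · intro r _ hr
    simp [hr]
  · simp

end

/-! ### Operator norms; monotonicity and Lipschitz constants of the interference map. -/

noncomputable section

open Matrix

section OperatorNorm

open scoped Matrix.Norms.L2Operator

lemma specRadius_eq_norm {n : ℕ} {A : Matrix (Fin n) (Fin n) ℂ} (hA : A.IsHermitian) :
    specRadius A = ‖A‖ := by
  rw [specRadius, IsSelfAdjoint.spectralRadius_eq_nnnorm hA]
  simp

lemma sigmaMax_eq_norm {m n : ℕ} (A : Matrix (Fin m) (Fin n) ℂ) : sigmaMax A = ‖A‖ := by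
  rw [sigmaMax, specRadius_eq_norm (isHermitian_conjTranspose_mul_self A),
    l2_opNorm_conjTranspose_mul_self, Real.sqrt_mul_self (norm_nonneg _)]

lemma sum_norm_mulVec_sq_le {m n : ℕ} (A : Matrix (Fin m) (Fin n) ℂ) (x : Fin n → ℂ) :
    ∑ i, ‖(A *ᵥ x) i‖ ^ 2 ≤ sigmaMax A ^ 2 * ∑ j, ‖x j‖ ^ 2 := by
  have h := l2_opNorm_mulVec A (WithLp.toLp 2 x)
  have h2 := pow_le_pow_left₀ (norm_nonneg _) h 2
  rw [mul_pow, EuclideanSpace.norm_sq_eq, EuclideanSpace.norm_sq_eq, ← sigmaMax_eq_norm] at h2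
  exact h2

lemma norm_dotProduct_mulVec_le {n : ℕ} {A : Matrix (Fin n) (Fin n) ℂ} (hA : A.IsHermitian)
    (x : Fin n → ℂ) : ‖star x ⬝ᵥ (A *ᵥ x)‖ ≤ specRadius A * ∑ j, ‖x j‖ ^ 2 := by
  have h := l2_opNorm_mulVec A (WithLp.toLp 2 x)
  have h2 := norm_inner_le_norm (𝕜 := ℂ) (WithLp.toLp 2 x) (WithLp.toLp 2 (A *ᵥ x))
  rw [EuclideanSpace.inner_eq_star_dotProduct, dotProduct_comm] at h2
  rw [specRadius_eq_norm hA, ← EuclideanSpace.norm_sq_eq (WithLp.toLp 2 x)]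
  calc _ ≤ _ := h2
    _ ≤ ‖WithLp.toLp 2 x‖ * (‖A‖ * ‖WithLp.toLp 2 x‖) :=
      mul_le_mul_of_nonneg_left h (norm_nonneg _)
    _ = _ := by ring

end OperatorNorm

lemma sigmaMax_nonneg {m n : ℕ} (A : Matrix (Fin m) (Fin n) ℂ) : 0 ≤ sigmaMax A :=
  Real.sqrt_nonneg _

lemma frobVec_mul_le {l m n : ℕ} (A : Matrix (Fin l) (Fin m) ℂ) (B : Matrix (Fin m) (Fin n) ℂ) :
    ‖frobVec (A * B)‖ ≤ sigmaMax A * ‖frobVec B‖ := by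
  refine le_of_sq_le_sq ?_ (mul_nonneg (sigmaMax_nonneg A) (norm_nonneg _))
  rw [mul_pow, frobVec_norm_sq, frobVec_norm_sq, Finset.sum_comm,
    Finset.sum_comm (f := fun i j => ‖B i j‖ ^ 2), Finset.mul_sum]
  exact Finset.sum_le_sum fun j _ => sum_norm_mulVec_sq_le A fun i => B i j

lemma frobVec_conjTranspose {m n : ℕ} (A : Matrix (Fin m) (Fin n) ℂ) :
    ‖frobVec Aᴴ‖ = ‖frobVec A‖ := by
  rw [← sq_eq_sq₀ (norm_nonneg _) (norm_nonneg _), frobVec_norm_sq, frobVec_norm_sq,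
    Finset.sum_comm]
  simp [conjTranspose_apply]

lemma frobVec_mul_mul_conjTranspose_le {m n : ℕ} (B : Matrix (Fin m) (Fin n) ℂ)
    (D : Matrix (Fin n) (Fin n) ℂ) : ‖frobVec (B * D * Bᴴ)‖ ≤ sigmaMax B ^ 2 * ‖frobVec D‖ := by
  have e : B * D * Bᴴ = B * (B * Dᴴ)ᴴ := by
    rw [conjTranspose_mul, conjTranspose_conjTranspose, Matrix.mul_assoc]
  calc _ ≤ sigmaMax B * ‖frobVec (B * Dᴴ)‖ := by
        rw [e, ← frobVec_conjTranspose (B * Dᴴ)]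
        exact frobVec_mul_le _ _
    _ ≤ sigmaMax B * (sigmaMax B * ‖frobVec D‖) := by
        rw [← frobVec_conjTranspose D]
        exact mul_le_mul_of_nonneg_left (frobVec_mul_le _ _) (sigmaMax_nonneg B)
    _ = _ := by ring

lemma sum_sq_mulVec_le_sigmaMax {m n : ℕ} (S : Matrix (Fin m) (Fin n) ℝ) (d : Fin n → ℝ) :
    ∑ q, (∑ r, S q r * d r) ^ 2 ≤ sigmaMax (S.map Complex.ofReal) ^ 2 * ∑ r, d r ^ 2 := by
  have h := sum_norm_mulVec_sq_le (S.map Complex.ofReal) fun r => (d r : ℂ)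
  have e : ∀ q, (S.map Complex.ofReal *ᵥ fun r => (d r : ℂ)) q = ((∑ r, S q r * d r : ℝ) : ℂ) := by
    intro q
    simp [mulVec, dotProduct]
  simpa only [e, Complex.norm_real, Real.norm_eq_abs, sq_abs] using h

/-- A quadratic form sees only the symmetric part of its matrix, for which the spectral radius is
the operator norm. -/
lemma sum_mul_mul_le_specRadius_symmPart {n : ℕ} (S : Matrix (Fin n) (Fin n) ℝ) (d : Fin n → ℝ) :
    ∑ q, ∑ r, S q r * d r * d q ≤
      specRadius ((symmPart S).map Complex.ofReal) * ∑ r, d r ^ 2 := by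
  have hA : ((symmPart S).map Complex.ofReal).IsHermitian := by
    ext i j
    simp [symmPart, add_comm]
  have h := norm_dotProduct_mulVec_le hA fun r => (d r : ℂ)
  have hcomm : ∑ q, ∑ r, S r q * d r * d q = ∑ q, ∑ r, S q r * d r * d q := by
    rw [Finset.sum_comm]
    exact Finset.sum_congr rfl fun q _ => Finset.sum_congr rfl fun r _ => by ring
  have e : star (fun r => (d r : ℂ)) ⬝ᵥ ((symmPart S).map Complex.ofReal *ᵥ fun r => (d r : ℂ)) =
      ((∑ q, ∑ r, S q r * d r * d q : ℝ) : ℂ) := by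
    have e2 : ∑ q, ∑ r, S q r * d r * d q =
        ∑ q, d q * ∑ r, (1 / 2 * (S q r + S r q)) * d r := by
      calc _ = (1 / 2) * (∑ q, ∑ r, S q r * d r * d q + ∑ q, ∑ r, S r q * d r * d q) := by
            rw [hcomm]; ring
        _ = _ := by
            rw [← Finset.sum_add_distrib, Finset.mul_sum]
            refine Finset.sum_congr rfl fun q _ => ?_
            rw [← Finset.sum_add_distrib, Finset.mul_sum, Finset.mul_sum]
            exact Finset.sum_congr rfl fun r _ => by ring
    rw [e2]
    simp [dotProduct, mulVec, symmPart, mul_add]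
  rw [e] at h
  simp only [Complex.norm_real, Real.norm_eq_abs, sq_abs] at h
  exact (le_abs_self _).trans h

namespace MIMONetwork

variable {Q : ℕ} {n : Fin Q → ℕ} (G : MIMONetwork Q n n)

/-- The interference-plus-noise covariance matrix seen through the inverse of the direct channel. -/
def effNoise (q : Fin Q) (Y : Profile n) : Matrix (Fin (n q)) (Fin (n q)) ℂ :=
  (G.H q q)⁻¹ * G.interferenceCov q Y * ((G.H q q)⁻¹)ᴴ

/-- The mapping of the variational inequality which characterizes the equilibria. -/
def viMap (Y : Profile n) : Profile n := fun q => G.effNoise q Y + Y q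

lemma viMap_sub (X Y : Profile n) (q : Fin Q) :
    G.viMap X q - G.viMap Y q = (X q - Y q) + ∑ r ∈ Finset.univ.erase q,
      ((G.H q q)⁻¹ * G.H q r) * (X r - Y r) * ((G.H q q)⁻¹ * G.H q r)ᴴ := by
  have e : G.effNoise q X - G.effNoise q Y = ∑ r ∈ Finset.univ.erase q,
      ((G.H q q)⁻¹ * G.H q r) * (X r - Y r) * ((G.H q q)⁻¹ * G.H q r)ᴴ := by
    rw [effNoise, effNoise, ← sub_mul, ← mul_sub, interferenceCov, interferenceCov,
      add_sub_add_left_eq_sub, ← Finset.sum_sub_distrib, Finset.mul_sum, Finset.sum_mul]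
    refine Finset.sum_congr rfl fun r _ => ?_
    simp only [conjTranspose_mul, Matrix.mul_assoc, mul_sub, sub_mul, Matrix.mul_sub,
      Matrix.sub_mul]
  rw [← e, viMap, viMap]
  abel

lemma norm_interference_le (X Y : Profile n) (q : Fin Q) :
    ‖frobVec (∑ r ∈ Finset.univ.erase q,
      ((G.H q q)⁻¹ * G.H q r) * (X r - Y r) * ((G.H q q)⁻¹ * G.H q r)ᴴ)‖ ≤
      ∑ r, G.interferenceMatrix q r * ‖frobVec (X r - Y r)‖ := by
  rw [map_sum]
  refine (norm_sum_le _ _).trans ?_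
  rw [← Finset.add_sum_erase _ _ (Finset.mem_univ q)]
  have h0 : G.interferenceMatrix q q = 0 := by rw [interferenceMatrix, of_apply, if_pos rfl]
  rw [h0, zero_mul, zero_add]
  refine Finset.sum_le_sum fun r hr => ?_
  have hr' : r ≠ q := Finset.ne_of_mem_erase hr
  have e : G.interferenceMatrix q r = sigmaMax ((G.H q q)⁻¹ * G.H q r) ^ 2 := by
    rw [interferenceMatrix, of_apply, if_neg hr']
  rw [e]
  exact frobVec_mul_mul_conjTranspose_le _ _

lemma profileNorm_sq (X : Profile n) : profileNorm X ^ 2 = ∑ q, ‖frobVec (X q)‖ ^ 2 := by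
  rw [← profileVec_norm, PiLp.norm_sq_eq_of_L2]
  rfl

lemma profileNorm_nonneg (X : Profile n) : 0 ≤ profileNorm X := Real.sqrt_nonneg _

/-- The variational inequality mapping is Lipschitz. -/
lemma viMap_lipschitz (X Y : Profile n) :
    profileNorm (G.viMap X - G.viMap Y) ≤
      sigmaMax ((1 + G.interferenceMatrix).map Complex.ofReal) * profileNorm (X - Y) := by
  refine le_of_sq_le_sq ?_ (mul_nonneg (sigmaMax_nonneg _) (profileNorm_nonneg _))
  rw [mul_pow, profileNorm_sq, profileNorm_sq]
  refine le_trans (Finset.sum_le_sum fun q _ => ?_)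
    (sum_sq_mulVec_le_sigmaMax (1 + G.interferenceMatrix) fun r => ‖frobVec (X r - Y r)‖)
  refine pow_le_pow_left₀ (norm_nonneg _) ?_ 2
  rw [Pi.sub_apply, viMap_sub, map_add]
  refine (norm_add_le _ _).trans ?_
  simp only [Matrix.add_apply, add_mul, Finset.sum_add_distrib]
  refine add_le_add (le_of_eq ?_) (G.norm_interference_le X Y q)
  simp [Matrix.one_apply]

/-- The variational inequality mapping is strongly monotone. -/
lemma viMap_strongly_monotone (X Y : Profile n) :
    (1 - specRadius ((symmPart G.interferenceMatrix).map Complex.ofReal)) *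
      profileNorm (X - Y) ^ 2 ≤
      ∑ q, ((G.viMap X q - G.viMap Y q)ᴴ * (X q - Y q)).trace.re := by
  have h := sum_mul_mul_le_specRadius_symmPart G.interferenceMatrix
    fun r => ‖frobVec (X r - Y r)‖
  -- Cauchy–Schwarz for each player reduces the claim to the quadratic form of the interference
  -- matrix at the vector of block norms.
  have key : ∀ q, ‖frobVec (X q - Y q)‖ ^ 2 -
      ∑ r, G.interferenceMatrix q r * ‖frobVec (X r - Y r)‖ * ‖frobVec (X q - Y q)‖ ≤
      ((G.viMap X q - G.viMap Y q)ᴴ * (X q - Y q)).trace.re := by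
    intro q
    rw [viMap_sub, ← frobVec_inner, map_add, inner_add_left, real_inner_self_eq_norm_sq,
      ← Finset.sum_mul]
    have h1 := abs_real_inner_le_norm (frobVec (∑ r ∈ Finset.univ.erase q,
      ((G.H q q)⁻¹ * G.H q r) * (X r - Y r) * ((G.H q q)⁻¹ * G.H q r)ᴴ)) (frobVec (X q - Y q))
    have h2 := mul_le_mul_of_nonneg_right (G.norm_interference_le X Y q)
      (norm_nonneg (frobVec (X q - Y q)))
    have h3 := neg_le_of_abs_le h1
    linarith
  have hsum := Finset.sum_le_sum fun q (_ : q ∈ Finset.univ) => key q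
  rw [Finset.sum_sub_distrib] at hsum
  rw [profileNorm_sq]
  simp only [Pi.sub_apply]
  linarith

end MIMONetwork

end

/-! ### Water-filling under varying power; existence and uniqueness for square channels. -/

noncomputable section

open Matrix

/-- Edelstein's fixed point theorem. -/
lemma IsCompact.exists_fixedPoint_of_dist_lt {α : Type*} [MetricSpace α] {K : Set α}
    (hK : IsCompact K) (hne : K.Nonempty) {T : α → α} (hT : Set.MapsTo T K K)
    (hlt : ∀ x ∈ K, ∀ y ∈ K, x ≠ y → dist (T x) (T y) < dist x y) : ∃ x ∈ K, T x = x := by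
  have hcont : ContinuousOn T K := by
    refine LipschitzOnWith.continuousOn (K := 1) (LipschitzOnWith.of_dist_le_mul fun x hx y hy => ?_)
    rcases eq_or_ne x y with rfl | h
    · simp
    · simpa using (hlt x hx y hy h).le
  -- If the minimizer `x` of the displacement were not fixed, `T x` would have a smaller one.
  obtain ⟨x, hx, hmin⟩ := hK.exists_isMinOn hne (f := fun x => dist x (T x))
    (continuous_dist.comp_continuousOn (continuousOn_id.prodMk hcont))
  refine ⟨x, hx, ?_⟩
  by_contra h
  exact absurd (hlt x hx (T x) (hT hx) (Ne.symm h)) (not_lt.2 (hmin (hT hx)))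

namespace Matrix

variable {ι : Type*} [Fintype ι] [DecidableEq ι]

/-- Rayleigh quotients at $v$: $v^HKv=\mu$ and $v^HK'v\ge\mu'$, while $vv^H$ has Frobenius norm 1.
-/
lemma level_sub_level_le {K K' : Matrix ι ι ℂ} (hK : K.IsHermitian) (hK' : K'.IsHermitian)
    {μ μ' : ℝ} {v : ι → ℂ} (hv : star v ⬝ᵥ v = 1) (hKv : K *ᵥ v = (μ : ℂ) • v)
    (hN : (K' - (μ' : ℂ) • (1 : Matrix ι ι ℂ)).PosSemidef) :
    μ' - μ ≤ ‖frobVec (K - K')‖ := by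
  set V := vecMulVec v (star v) with hV
  have hVV : Vᴴ * V = V := by
    rw [(posSemidef_vecMulVec_self_star v).isHermitian.eq, hV, vecMulVec_mul_vecMulVec, hv, one_smul]
  have htr : V.trace = 1 := by rw [hV, trace_vecMulVec, dotProduct_comm, hv]
  have hn : ‖frobVec V‖ = 1 := by
    rw [← sq_eq_sq₀ (norm_nonneg _) zero_le_one, ← real_inner_self_eq_norm_sq, frobVec_inner, hVV,
      htr]
    simp
  have h1 := neg_le_of_abs_le (abs_real_inner_le_norm (frobVec (K - K')) (frobVec V))
  rw [frobVec_inner, hn, mul_one, (hK.sub hK').eq, sub_mul, trace_sub, Complex.sub_re,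
    trace_mul_vecMulVec_star, hKv, dotProduct_smul, hv, smul_eq_mul, mul_one,
    Complex.ofReal_re] at h1
  have h2 := hN.trace_mul_re_nonneg (posSemidef_vecMulVec_self_star v)
  rw [sub_mul, trace_sub, Complex.sub_re, smul_mul, one_mul, trace_smul, ← hV, htr, smul_eq_mul,
    mul_one, Complex.ofReal_re] at h2
  linarith

/-- Monotonicity bound for two water-filling solutions with different powers. -/
lemma IsWaterfilling.trace_sub_mul_sub_le [Nonempty ι] {W W' X X' : Matrix ι ι ℂ} {p p' : ℝ}
    (hW : W.PosDef) (hW' : W'.PosDef) (h : IsWaterfilling W p X) (h' : IsWaterfilling W' p' X') :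
    ((W + X - (W' + X'))ᴴ * (X - X')).trace.re ≤
      ‖frobVec (W + X - (W' + X'))‖ * |p - p'| := by
  obtain ⟨μ, v, -, hv, hKv, hN, hNX⟩ := h.exists_waterLevel hW
  obtain ⟨μ', v', -, hv', hKv', hN', hNX'⟩ := h'.exists_waterLevel hW'
  obtain ⟨hX, hp, -⟩ := h
  obtain ⟨hX', hp', -⟩ := h'
  have hK := (hW.add_posSemidef hX).isHermitian
  have hK' := (hW'.add_posSemidef hX').isHermitian
  set K := W + X
  set K' := W' + X'
  have hμ : |μ - μ'| ≤ ‖frobVec (K - K')‖ := by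
    rw [abs_le]
    have h1 := level_sub_level_le hK hK' hv hKv hN'
    have h2 := level_sub_level_le hK' hK hv' hKv' hN
    rw [← neg_sub K K', map_neg, norm_neg] at h2
    constructor <;> linarith
  have hlevel : ∀ (A B : Matrix ι ι ℂ) (a : ℝ),
      ((A - (a : ℂ) • (1 : Matrix ι ι ℂ)) * B).trace.re = (A * B).trace.re - a * B.trace.re := by
    intro A B a
    rw [sub_mul, trace_sub, Complex.sub_re, smul_mul, one_mul, trace_smul, smul_eq_mul,
      Complex.re_ofReal_mul]
  have e1 := hlevel K X μ
  have e2 := hlevel K' X' μ'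
  have e3 := hN.trace_mul_re_nonneg hX'
  have e4 := hN'.trace_mul_re_nonneg hX
  rw [hlevel, hp'] at e3
  rw [hlevel, hp] at e4
  rw [hNX, hp] at e1
  rw [hNX', hp'] at e2
  simp only [trace_zero, Complex.zero_re] at e1 e2
  -- The diagonal terms equal $\mu p$ and $\mu'p'$ by slackness; the cross terms are at least $\mu
  -- p'$ and $\mu'p$.
  calc ((K - K')ᴴ * (X - X')).trace.re ≤ (μ - μ') * (p - p') := by
        rw [(hK.sub hK').eq]
        simp only [sub_mul, mul_sub, trace_sub, Complex.sub_re]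
        linarith
    _ ≤ |μ - μ'| * |p - p'| := by
        rw [← abs_mul]
        exact le_abs_self _
    _ ≤ _ := mul_le_mul_of_nonneg_right hμ (abs_nonneg _)

end Matrix

namespace MIMONetwork

section Covariance

variable {Q : ℕ} {nR nT : Fin Q → ℕ}

lemma interferenceCov_posDef (G : MIMONetwork Q nR nT) {Y : Profile nT}
    (hY : ∀ q, (Y q).PosSemidef) (q : Fin Q) : (G.interferenceCov q Y).PosDef :=
  (G.Rn_posDef q).add_posSemidef
    (posSemidef_sum _ fun r _ => (hY r).mul_mul_conjTranspose_same _)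

end Covariance

variable {Q : ℕ} {n : Fin Q → ℕ} {G : MIMONetwork Q n n}

lemma effNoise_inv (hH : ∀ q, IsUnit (G.H q q)) (q : Fin Q) (Y : Profile n) :
    (G.effNoise q Y)⁻¹ = (G.H q q)ᴴ * (G.interferenceCov q Y)⁻¹ * G.H q q := by
  have hu : IsUnit (G.H q q).det := (isUnit_iff_isUnit_det _).1 (hH q)
  rw [effNoise, Matrix.mul_inv_rev, Matrix.mul_inv_rev, nonsing_inv_nonsing_inv _ hu, conjTranspose_nonsing_inv,
    nonsing_inv_nonsing_inv, ← mul_assoc]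
  rw [det_conjTranspose]
  exact hu.star

lemma effNoise_posDef (hH : ∀ q, IsUnit (G.H q q)) {Y : Profile n}
    (hY : ∀ q, (Y q).PosSemidef) (q : Fin Q) : (G.effNoise q Y).PosDef := by
  refine (G.interferenceCov_posDef hY q).mul_mul_conjTranspose_same ?_
  rw [vecMul_injective_iff_isUnit]
  exact isUnit_nonsing_inv_iff.2 (hH q)

lemma rate_eq_effRate (hH : ∀ q, IsUnit (G.H q q)) (q : Fin Q) (Y : Profile n)
    (X : Matrix (Fin (n q)) (Fin (n q)) ℂ) : G.rate q X Y = effRate (G.effNoise q Y) X := by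
  rw [rate, effRate, effNoise_inv hH]

lemma energyEff_eq_effEE (hH : ∀ q, IsUnit (G.H q q)) (q : Fin Q) (Y : Profile n)
    (X : Matrix (Fin (n q)) (Fin (n q)) ℂ) :
    G.energyEff q X Y = effEE (G.effNoise q Y) (G.Psi q) X := by
  rw [energyEff, effEE, rate_eq_effRate hH]

lemma exists_isWaterfilling (hn : ∀ q, 0 < n q) (hH : ∀ q, IsUnit (G.H q q)) {Y : Profile n}
    (hY : ∀ q, (Y q).PosSemidef) (q : Fin Q) {p : ℝ} (hp : 0 ≤ p) :
    ∃ X, IsWaterfilling (G.effNoise q Y) p X := by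
  obtain ⟨X, hX, hVI⟩ := exists_powerSlice_solution hn (p := fun _ => p) (fun _ => hp)
    (fun X => fun q => G.effNoise q Y + X q) (c := 1) (L := 1) one_pos
    (fun X Z => by
      simp only [add_sub_add_left_eq_sub]
      rw [one_mul, ← profileVec_norm, ← real_inner_self_eq_norm_sq, profileVec_inner]
      rfl)
    (fun X Z => by
      rw [one_mul]
      refine le_of_eq (congrArg profileNorm ?_)
      funext q
      simp)
  refine ⟨X q, (hX q).1, (hX q).2, fun Z hZ hZp => ?_⟩
  have := hVI q Z hZ hZp
  rwa [((effNoise_posDef hH hY q).add_posSemidef (hX q).1).isHermitian.eq] at this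

/-- Solutions of the variational inequality with prescribed powers. -/
def IsWaterfillingProfile (G : MIMONetwork Q n n) (p : Fin Q → ℝ) (X : Profile n) : Prop :=
  ∀ q, IsWaterfilling (G.effNoise q X) (p q) (X q)

lemma exists_isWaterfillingProfile (hn : ∀ q, 0 < n q) (hH : ∀ q, IsUnit (G.H q q))
    (hc : 0 < 1 - specRadius ((symmPart G.interferenceMatrix).map Complex.ofReal))
    {p : Fin Q → ℝ} (hp : ∀ q, 0 ≤ p q) : ∃ X, G.IsWaterfillingProfile p X := by
  obtain ⟨X, hX, hVI⟩ := exists_powerSlice_solution hn hp G.viMap hc G.viMap_strongly_monotone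
    G.viMap_lipschitz
  refine ⟨X, fun q => ⟨(hX q).1, (hX q).2, fun Z hZ hZp => ?_⟩⟩
  have := hVI q Z hZ hZp
  rwa [viMap, ((effNoise_posDef hH (fun r => (hX r).1) q).add_posSemidef (hX q).1).isHermitian.eq]
    at this

/-- Existence and uniqueness of the maximizer make the supremum in `unconstrainedPower` a genuine
trace. -/
lemma exists_powerMap_eq (hn : ∀ q, 0 < n q) (hH : ∀ q, IsUnit (G.H q q)) {Y : Profile n}
    (hY : ∀ q, (Y q).PosSemidef) (q : Fin Q) :
    ∃ Xu : Matrix (Fin (n q)) (Fin (n q)) ℂ, Xu.PosSemidef ∧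
      (∀ Z : Matrix (Fin (n q)) (Fin (n q)) ℂ, Z.PosSemidef →
        effEE (G.effNoise q Y) (G.Psi q) Z ≤ effEE (G.effNoise q Y) (G.Psi q) Xu) ∧
      G.powerMap Y q = min (G.P q) Xu.trace.re := by
  have : Nonempty (Fin (n q)) := ⟨⟨0, hn q⟩⟩
  have hW := effNoise_posDef hH hY q
  obtain ⟨Xu, hXu, hmax⟩ := exists_effEE_max hW (G.Psi_pos q)
  refine ⟨Xu, hXu, hmax, ?_⟩
  have harg : G.unconstrainedArgmax q Y = {Xu} := by
    ext X
    simp only [unconstrainedArgmax, energyEff_eq_effEE hH, Set.mem_ofPred_eq, Set.mem_singleton_iff]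
    constructor
    · rintro ⟨hX, hXmax⟩
      exact effEE_maximizer_unique hW (G.Psi_pos q) convex_univ hX (Set.mem_univ _)
        (fun Z hZ _ => hXmax Z hZ) hXu (Set.mem_univ _) (hmax X hX)
    · rintro rfl
      exact ⟨hXu, hmax⟩
  simp [powerMap, unconstrainedPower, harg]

lemma powerMap_nonneg (hn : ∀ q, 0 < n q) (hH : ∀ q, IsUnit (G.H q q)) {Y : Profile n}
    (hY : ∀ q, (Y q).PosSemidef) (q : Fin Q) : 0 ≤ G.powerMap Y q := by
  obtain ⟨Xu, hXu, -, h⟩ := exists_powerMap_eq hn hH hY q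
  exact h ▸ le_min (G.P_nonneg q) hXu.trace_re_nonneg

lemma powerMap_le (Y : Profile n) (q : Fin Q) : G.powerMap Y q ≤ G.P q :=
  min_le_left _ _

/-- The equilibria are the water-filling profiles whose powers are given by the power map. -/
lemma isNashEquilibrium_iff (hn : ∀ q, 0 < n q) (hH : ∀ q, IsUnit (G.H q q)) (Y : Profile n) :
    G.IsNashEquilibrium Y ↔ G.IsWaterfillingProfile (G.powerMap Y) Y := by
  have key : (∀ q, (Y q).PosSemidef) → ∀ q,
      (Y q ∈ G.strategySet q ∧ ∀ X ∈ G.strategySet q, G.energyEff q X Y ≤ G.energyEff q (Y q) Y) ↔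
        IsWaterfilling (G.effNoise q Y) (G.powerMap Y q) (Y q) := by
    intro hY q
    have : Nonempty (Fin (n q)) := ⟨⟨0, hn q⟩⟩
    obtain ⟨Xu, hXu, hmax, h⟩ := exists_powerMap_eq hn hH hY q
    rw [h, ← effEE_bestResponse_iff (effNoise_posDef hH hY q) (G.Psi_pos q) (G.P_nonneg q)
      (fun p hp => exists_isWaterfilling hn hH hY q hp) hXu hmax]
    simp only [strategySet, Set.mem_ofPred_eq, energyEff_eq_effEE hH, and_imp]
  constructor
  · exact fun h q => (key (fun r => (h r).1.1) q).1 (h q)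
  · exact fun h q => (key (fun r => (h r).1) q).2 (h q)

/-- Water-filling profiles depend on the powers in a Lipschitz way. -/
lemma IsWaterfillingProfile.norm_sub_le (hn : ∀ q, 0 < n q) (hH : ∀ q, IsUnit (G.H q q))
    {p p' : EuclideanSpace ℝ (Fin Q)} {X X' : Profile n} (h : G.IsWaterfillingProfile p X)
    (h' : G.IsWaterfillingProfile p' X') :
    (1 - specRadius ((symmPart G.interferenceMatrix).map Complex.ofReal)) *
      profileNorm (X - X') ^ 2 ≤
      sigmaMax ((1 + G.interferenceMatrix).map Complex.ofReal) * profileNorm (X - X') *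
        ‖p - p'‖ := by
  refine (G.viMap_strongly_monotone X X').trans ?_
  have h1 : ∑ q, ((G.viMap X q - G.viMap X' q)ᴴ * (X q - X' q)).trace.re ≤
      ∑ q, ‖frobVec (G.viMap X q - G.viMap X' q)‖ * |p q - p' q| := by
    refine Finset.sum_le_sum fun q _ => ?_
    have : Nonempty (Fin (n q)) := ⟨⟨0, hn q⟩⟩
    exact (h q).trace_sub_mul_sub_le (effNoise_posDef hH (fun r => (h r).1) q)
      (effNoise_posDef hH (fun r => (h' r).1) q) (h' q)
  have h2 : ∑ q, ‖frobVec (G.viMap X q - G.viMap X' q)‖ * |p q - p' q| ≤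
      profileNorm (G.viMap X - G.viMap X') * ‖p - p'‖ := by
    refine le_of_sq_le_sq ?_ (mul_nonneg (profileNorm_nonneg _) (norm_nonneg _))
    rw [mul_pow, profileNorm_sq, EuclideanSpace.norm_sq_eq]
    exact Finset.sum_mul_sq_le_sq_mul_sq _ _ _
  exact h1.trans (h2.trans (mul_le_mul_of_nonneg_right (G.viMap_lipschitz X X') (norm_nonneg _)))

/-- Here the hypothesis on the power map is vacuous and says nothing about the constants, so this
case is handled apart. -/
lemma existsUnique_nash_of_subsingleton (h : G.profileSet.Subsingleton) :
    ∃! Y : Profile n, G.IsNashEquilibrium Y := by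
  have h0 : (0 : Profile n) ∈ G.profileSet := fun q =>
    ⟨PosSemidef.zero, by simpa using G.P_nonneg q⟩
  refine ⟨0, fun q => ⟨h0 q, fun X hX => ?_⟩, fun Y hY => h (fun q => (hY q).1) h0⟩
  have hmem : Function.update (0 : Profile n) q X ∈ G.profileSet := by
    intro r
    rcases eq_or_ne r q with rfl | hr
    · simpa using hX
    · rw [Function.update_of_ne hr]
      exact h0 r
  have := congrFun (h hmem h0) q
  rw [Function.update_self] at this
  rw [this]

/-- Existence and uniqueness of the equilibrium when the direct channels are square and
nonsingular. -/
theorem existsUnique_nash (hn : ∀ q, 0 < n q) (hH : ∀ q, IsUnit (G.H q q))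
    (hp : ∀ Y ∈ G.profileSet, ∀ Y' ∈ G.profileSet, Y ≠ Y' →
      ‖G.powerMap Y - G.powerMap Y'‖ <
        (1 - specRadius ((symmPart G.interferenceMatrix).map Complex.ofReal)) /
          sigmaMax ((1 + G.interferenceMatrix).map Complex.ofReal) * profileNorm (Y - Y')) :
    ∃! Y : Profile n, G.IsNashEquilibrium Y := by
  by_cases hsub : G.profileSet.Subsingleton
  · exact existsUnique_nash_of_subsingleton hsub
  set c := 1 - specRadius ((symmPart G.interferenceMatrix).map Complex.ofReal) with hcdef
  set L := sigmaMax ((1 + G.interferenceMatrix).map Complex.ofReal) with hLdef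
  have hL0 : 0 ≤ L := sigmaMax_nonneg _
  obtain ⟨Y₁, hY₁, Y₂, hY₂, hne⟩ := Set.not_subsingleton_iff.1 hsub
  -- The strict hypothesis at one pair of distinct profiles forces the constant to be positive; as
  -- division by zero gives 0, also $L\ne0$.
  have hcL : 0 < c / L :=
    pos_of_mul_pos_left ((norm_nonneg _).trans_lt (hp Y₁ hY₁ Y₂ hY₂ hne)) (profileNorm_nonneg _)
  have hL : 0 < L := hL0.lt_of_ne fun h => by simp [← h] at hcL
  have hc : 0 < c := by
    have := mul_pos hcL hL
    rwa [div_mul_cancel₀ _ hL.ne'] at this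
  have hlip : ∀ {p p' : EuclideanSpace ℝ (Fin Q)} {X X' : Profile n},
      G.IsWaterfillingProfile p X → G.IsWaterfillingProfile p' X' →
      X ≠ X' → c / L * profileNorm (X - X') ≤ ‖p - p'‖ := by
    intro p p' X X' h h' hne
    have hpos : 0 < profileNorm (X - X') := by
      rw [← profileVec_norm, norm_pos_iff]
      exact fun h0 => hne (sub_eq_zero.1 (profileVec.map_eq_zero_iff.1 h0))
    have := IsWaterfillingProfile.norm_sub_le hn hH h h'
    rw [div_mul_eq_mul_div, div_le_iff₀ hL]
    nlinarith
  have hmem : ∀ {p : Fin Q → ℝ} {X : Profile n}, G.IsWaterfillingProfile p X →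
      (∀ q, p q ≤ G.P q) → X ∈ G.profileSet := fun h hP q =>
    ⟨(h q).1, (h q).2.1.trans_le (hP q)⟩
  -- The value at powers with a negative component is arbitrary; this makes $p\mapsto X(p)$ total.
  have hsol : ∀ p : EuclideanSpace ℝ (Fin Q), ∃ X, (∀ q, 0 ≤ p q) →
      G.IsWaterfillingProfile p X := by
    intro p
    by_cases h : ∀ q, 0 ≤ p q
    · obtain ⟨X, hX⟩ := exists_isWaterfillingProfile hn hH hc h
      exact ⟨X, fun _ => hX⟩
    · exact ⟨0, fun h' => absurd h' h⟩
  choose X hX using hsol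
  have hbox : IsCompact {p : EuclideanSpace ℝ (Fin Q) | ∀ q, p q ∈ Set.Icc 0 (G.P q)} := by
    have := (isCompact_univ_pi fun q => isCompact_Icc (a := 0) (b := G.P q)).image
      (PiLp.continuous_toLp 2 fun _ : Fin Q => ℝ)
    convert! this using 1
    ext p
    constructor
    · exact fun h => ⟨p, fun q _ => h q, rfl⟩
    · rintro ⟨x, hx, rfl⟩ q
      exact hx q (Set.mem_univ q)
  obtain ⟨p, hpB, hfix⟩ := hbox.exists_fixedPoint_of_dist_lt (T := fun p => G.powerMap (X p))
    ⟨0, fun q => ⟨le_rfl, G.P_nonneg q⟩⟩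
    (fun p hp q => ⟨powerMap_nonneg hn hH (fun r => (hX p (fun q => (hp q).1) r).1) q,
      powerMap_le _ q⟩)
    (fun p hpB p' hpB' hne => by
      rw [dist_eq_norm, dist_eq_norm]
      have h1 := hX p fun q => (hpB q).1
      have h2 := hX p' fun q => (hpB' q).1
      rcases eq_or_ne (X p) (X p') with h | h
      · rw [h, sub_self, norm_zero, norm_pos_iff, sub_ne_zero]
        exact hne
      · exact (hp _ (hmem h1 fun q => (hpB q).2) _ (hmem h2 fun q => (hpB' q).2) h).trans_le
          (hlip h1 h2 h))
  refine ⟨X p, ?_, fun Y hY => ?_⟩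
  · change G.IsNashEquilibrium (X p)
    rw [isNashEquilibrium_iff hn hH, hfix]
    exact hX p fun q => (hpB q).1
  · have hXp : G.IsWaterfillingProfile (G.powerMap (X p)) (X p) := by
      rw [hfix]
      exact hX p fun q => (hpB q).1
    replace hY := (isNashEquilibrium_iff hn hH Y).1 hY
    -- For distinct equilibria, the hypothesis bounds the distance of their powers strictly from
    -- above by what `hlip` bounds it from below.
    by_contra hne
    exact absurd (hp _ (hmem hY (powerMap_le _)) _ (hmem hXp (powerMap_le _)) hne)
      (not_lt.2 (hlip hY hXp hne))

end MIMONetwork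

end

/-! ### Reduction of the game to the row spaces of the direct channels. -/

noncomputable section

open Matrix

namespace Matrix

variable {k l : Type*} [Fintype k] [Fintype l]

lemma trace_compress [DecidableEq k] {V : Matrix k l ℂ} (X : Matrix k k ℂ) :
    (X * (1 - V * Vᴴ)).trace.re = X.trace.re - (Vᴴ * X * V).trace.re := by
  rw [mul_sub, mul_one, trace_sub, Complex.sub_re, ← Matrix.mul_assoc, trace_mul_comm _ Vᴴ,
    ← Matrix.mul_assoc]

variable [DecidableEq l]

lemma trace_isometry_conj {V : Matrix k l ℂ} (hV : Vᴴ * V = 1)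
    (Z : Matrix l l ℂ) : (V * Z * Vᴴ).trace = Z.trace := by
  rw [trace_mul_comm, ← Matrix.mul_assoc, hV, Matrix.one_mul]

variable [DecidableEq k]

lemma posSemidef_one_sub_isometry {V : Matrix k l ℂ} (hV : Vᴴ * V = 1) :
    (1 - V * Vᴴ).PosSemidef := by
  have h : (1 - V * Vᴴ) = (1 - V * Vᴴ)ᴴ * (1 - V * Vᴴ) := by
    have e : V * Vᴴ * (V * Vᴴ) = V * Vᴴ := by
      rw [Matrix.mul_assoc, ← Matrix.mul_assoc Vᴴ, hV, Matrix.one_mul]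
    simp [sub_mul, mul_sub, e]
  rw [h]
  exact posSemidef_conjTranspose_mul_self _

lemma PosSemidef.trace_compress_le {V : Matrix k l ℂ} (hV : Vᴴ * V = 1) {X : Matrix k k ℂ}
    (hX : X.PosSemidef) : (Vᴴ * X * V).trace.re ≤ X.trace.re := by
  have := hX.trace_mul_re_nonneg (posSemidef_one_sub_isometry hV)
  rw [trace_compress] at this
  linarith

lemma PosSemidef.eq_conj_compress {V : Matrix k l ℂ} (hV : Vᴴ * V = 1) {X : Matrix k k ℂ}
    (hX : X.PosSemidef) (h : X.trace.re ≤ (Vᴴ * X * V).trace.re) :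
    X = V * (Vᴴ * X * V) * Vᴴ := by
  have h0 := hX.mul_eq_zero_of_trace_re (posSemidef_one_sub_isometry hV)
    (by rw [trace_compress]; linarith)
  rw [mul_sub, mul_one, sub_eq_zero] at h0
  have h1 : X = V * Vᴴ * X := by
    have : Xᴴ = (X * (V * Vᴴ))ᴴ := by rw [← h0]
    simpa [conjTranspose_mul, hX.isHermitian.eq, Matrix.mul_assoc] using this
  calc X = V * Vᴴ * (X * (V * Vᴴ)) := by rw [← h0, ← h1]
    _ = _ := by simp only [Matrix.mul_assoc]

/-- The rate only depends on the compression of the strategy to the row space of the channel. -/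
lemma det_rate_compress {j : Type*} [Fintype j] [DecidableEq j] {H : Matrix j k ℂ}
    {V : Matrix k l ℂ} (hH : H = H * V * Vᴴ) (R : Matrix j j ℂ) (X : Matrix k k ℂ) :
    (1 + Hᴴ * R * H * X).det = (1 + (H * V)ᴴ * R * (H * V) * (Vᴴ * X * V)).det := by
  have e1 : Hᴴ * R * H * X = V * ((H * V)ᴴ * R * (H * V) * (Vᴴ * X)) := by
    conv_lhs => rw [hH]
    simp only [conjTranspose_mul, conjTranspose_conjTranspose, Matrix.mul_assoc]
  -- Sylvester's identity $\det(I+AB)=\det(I+BA)$ moves the outer $V$ to the right.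
  rw [e1, det_one_add_mul_comm]
  simp only [Matrix.mul_assoc]

end Matrix

namespace MIMONetwork

variable {Q : ℕ} {nR nT : Fin Q → ℕ} {n : Fin Q → ℕ} {G : MIMONetwork Q nR nT}
  {V : (q : Fin Q) → Matrix (Fin (nT q)) (Fin (n q)) ℂ}

/-- The profile `V q * Y q * (V q)ᴴ` obtained by expanding a reduced profile. -/
def expand (V : (q : Fin Q) → Matrix (Fin (nT q)) (Fin (n q)) ℂ) (Y : Profile n) : Profile nT :=
  fun q => V q * Y q * (V q)ᴴ

lemma interferenceCov_expand (q : Fin Q) (Y : Profile n) :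
    G.interferenceCov q (expand V Y) = (G.reduce V).interferenceCov q Y := by
  simp only [interferenceCov, expand, reduce, conjTranspose_mul, Matrix.mul_assoc]

lemma rate_expand (hHV : ∀ q, G.H q q = G.H q q * V q * (V q)ᴴ) (q : Fin Q) (Y : Profile n)
    (X : Matrix (Fin (nT q)) (Fin (nT q)) ℂ) :
    G.rate q X (expand V Y) = (G.reduce V).rate q ((V q)ᴴ * X * V q) Y := by
  rw [rate, rate, interferenceCov_expand, det_rate_compress (hHV q)]
  rfl

end MIMONetwork

namespace MIMONetwork

variable {Q : ℕ} {nR nT : Fin Q → ℕ} {G : MIMONetwork Q nR nT}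
  {V : (q : Fin Q) → Matrix (Fin (nT q)) (Fin (nR q)) ℂ}

lemma energyEff_expand (hV : ∀ q, (V q)ᴴ * V q = 1)
    (hHV : ∀ q, G.H q q = G.H q q * V q * (V q)ᴴ) (q : Fin Q) (Y : Profile nR)
    (Z : Matrix (Fin (nR q)) (Fin (nR q)) ℂ) :
    G.energyEff q (V q * Z * (V q)ᴴ) (expand V Y) = (G.reduce V).energyEff q Z Y := by
  have e : (V q)ᴴ * (V q * Z * (V q)ᴴ) * V q = Z := by
    calc _ = ((V q)ᴴ * V q) * Z * ((V q)ᴴ * V q) := by simp only [Matrix.mul_assoc]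
      _ = Z := by rw [hV, Matrix.one_mul, Matrix.mul_one]
  rw [energyEff, energyEff, rate_expand hHV, e, trace_isometry_conj (hV q)]
  rfl

/-- At an equilibrium no power is spent outside the row spaces of the direct channels. -/
lemma IsNashEquilibrium.eq_expand (hnR : ∀ q, 0 < nR q) (hV : ∀ q, (V q)ᴴ * V q = 1)
    (hHV : ∀ q, G.H q q = G.H q q * V q * (V q)ᴴ) (hH : ∀ q, IsUnit (G.H q q * V q))
    {Y : Profile nT} (hY : G.IsNashEquilibrium Y) (q : Fin Q) :
    Y q = V q * ((V q)ᴴ * Y q * V q) * (V q)ᴴ := by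
  have : Nonempty (Fin (nR q)) := ⟨⟨0, hnR q⟩⟩
  obtain ⟨⟨hX, hXP⟩, hmax⟩ := hY q
  set X := Y q with hXdef
  have hR := G.interferenceCov_posDef (fun r => (hY r).1.1) q
  have hA := hR.inv.conjTranspose_mul_mul_same (mulVec_injective_iff_isUnit.2 (hH q))
  -- The other components of `Y` are not yet known to be expansions, so the effective noise `A⁻¹` is
  -- built from the original covariance.
  set A := (G.H q q * V q)ᴴ * (G.interferenceCov q Y)⁻¹ * (G.H q q * V q) with hAdef
  have hAu : IsUnit A.det := (isUnit_iff_isUnit_det _).1 hA.isUnit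
  have hrate : ∀ Z, G.rate q Z Y = effRate A⁻¹ ((V q)ᴴ * Z * V q) := by
    intro Z
    rw [rate, effRate, det_rate_compress (hHV q), nonsing_inv_nonsing_inv _ hAu]
  have hee : ∀ Z : Matrix (Fin (nR q)) (Fin (nR q)) ℂ,
      G.energyEff q (V q * Z * (V q)ᴴ) Y = effRate A⁻¹ Z / (G.Psi q + Z.trace.re) := by
    intro Z
    have e : (V q)ᴴ * (V q * Z * (V q)ᴴ) * V q = Z := by
      calc _ = ((V q)ᴴ * V q) * Z * ((V q)ᴴ * V q) := by simp only [Matrix.mul_assoc]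
        _ = Z := by rw [hV, Matrix.one_mul, Matrix.mul_one]
    rw [energyEff, hrate, e, trace_isometry_conj (hV q)]
  have hEX : G.energyEff q X Y =
      effRate A⁻¹ ((V q)ᴴ * X * V q) / (G.Psi q + X.trace.re) := by
    rw [energyEff, hrate]
  have hXb := hX.conjTranspose_mul_mul_same (V q)
  have hψ := G.Psi_pos q
  apply hX.eq_conj_compress (hV q)
  by_contra! hlt
  -- If the compression vanishes, so does the rate, and saving power gains nothing. The deviation is
  -- then an isotropic strategy of the same trace, whose rate is positive. Otherwise the compression
  -- itself keeps the positive rate at lower power.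
  by_cases h0 : (V q)ᴴ * X * V q = 0
  · rw [h0, trace_zero, Complex.zero_re] at hlt
    have hZ : ((X.trace.re / nR q : ℝ) • (1 : Matrix (Fin (nR q)) (Fin (nR q)) ℂ)).PosSemidef :=
      PosSemidef.one.smul (div_nonneg hlt.le (Nat.cast_nonneg _))
    have hnq : (0 : ℝ) < nR q := by exact_mod_cast hnR q
    have hZ0 : ((X.trace.re / nR q : ℝ) • (1 : Matrix (Fin (nR q)) (Fin (nR q)) ℂ)) ≠ 0 :=
      smul_ne_zero (div_pos hlt hnq).ne' one_ne_zero
    have htr : ((X.trace.re / nR q : ℝ) •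
        (1 : Matrix (Fin (nR q)) (Fin (nR q)) ℂ)).trace.re = X.trace.re := by
      simp [trace_smul, div_mul_cancel₀ _ hnq.ne']
    have h1 := hmax _ ⟨hZ.mul_mul_conjTranspose_same (V q), by
      rw [trace_isometry_conj (hV q), htr]
      exact hXP⟩
    rw [hee, hEX, h0, effRate_zero, zero_div, htr] at h1
    have h2 := div_pos (effRate_pos hA.inv hZ hZ0) (by linarith : 0 < G.Psi q + X.trace.re)
    linarith
  · have h1 := hmax _ ⟨hXb.mul_mul_conjTranspose_same (V q), by
      rw [trace_isometry_conj (hV q)]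
      exact hlt.le.trans hXP⟩
    rw [hee, hEX] at h1
    have h2 := hXb.trace_re_nonneg
    exact absurd h1 (not_le.2 (div_lt_div_of_pos_left (effRate_pos hA.inv hXb h0)
      (by linarith) (by linarith)))

/-- The equilibria of the original game are the expansions of those of the reduced game. -/
lemma isNashEquilibrium_iff_exists_expand (hnR : ∀ q, 0 < nR q) (hV : ∀ q, (V q)ᴴ * V q = 1)
    (hHV : ∀ q, G.H q q = G.H q q * V q * (V q)ᴴ) (hH : ∀ q, IsUnit (G.H q q * V q))
    (Y : Profile nT) :
    G.IsNashEquilibrium Y ↔ ∃ Z, (G.reduce V).IsNashEquilibrium Z ∧ Y = expand V Z := by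
  constructor
  · intro hY
    have hYe : Y = expand V fun q => (V q)ᴴ * Y q * V q :=
      funext fun q => hY.eq_expand hnR hV hHV hH q
    refine ⟨_, fun q => ⟨⟨(hY q).1.1.conjTranspose_mul_mul_same (V q), ?_⟩, fun Z hZ => ?_⟩, hYe⟩
    · exact ((hY q).1.1.trace_compress_le (hV q)).trans (hY q).1.2
    · have h := (hY q).2 (V q * Z * (V q)ᴴ) ⟨hZ.1.mul_mul_conjTranspose_same (V q), by
        rw [trace_isometry_conj (hV q)]
        exact hZ.2⟩
      rw [congrFun hYe q] at h
      rw [← energyEff_expand hV hHV, ← energyEff_expand hV hHV, ← hYe]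
      exact h
  · rintro ⟨Z, hZ, rfl⟩ q
    refine ⟨⟨(hZ q).1.1.mul_mul_conjTranspose_same (V q), ?_⟩, fun X hX => ?_⟩
    · rw [expand, trace_isometry_conj (hV q)]
      exact (hZ q).1.2
    · have hXb := hX.1.conjTranspose_mul_mul_same (V q)
      have htr := hX.1.trace_compress_le (hV q)
      have h := (hZ q).2 _ ⟨hXb, htr.trans hX.2⟩
      -- Lowering the power in the denominator increases the quotient only because the rate is
      -- nonnegative.
      have hnonneg : 0 ≤ (G.reduce V).rate q ((V q)ᴴ * X * V q) Z := by
        have hHr : ∀ q, IsUnit ((G.reduce V).H q q) := hH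
        rw [rate_eq_effRate hHr]
        exact effRate_nonneg (effNoise_posDef hHr (fun r => (hZ r).1.1) q) hXb
      have h2 := hXb.trace_re_nonneg
      have hψ := G.Psi_pos q
      calc G.energyEff q X (expand V Z)
          = (G.reduce V).rate q ((V q)ᴴ * X * V q) Z / (G.Psi q + X.trace.re) := by
            rw [energyEff, rate_expand hHV]
        _ ≤ (G.reduce V).rate q ((V q)ᴴ * X * V q) Z /
              (G.Psi q + ((V q)ᴴ * X * V q).trace.re) :=
            div_le_div_of_nonneg_left hnonneg (by linarith) (by linarith)
        _ ≤ (G.reduce V).energyEff q (Z q) Z := h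
        _ = G.energyEff q (expand V Z q) (expand V Z) := (energyEff_expand hV hHV q Z (Z q)).symm

end MIMONetwork

end

theorem proposition3 {Q : ℕ} {nR nT : Fin Q → ℕ} (hnR : ∀ q, 0 < nR q)
    (G : MIMONetwork Q nR nT)
    -- compact singular value decompositions of the direct channels, with `r_q = nR q`
    (U : (q : Fin Q) → Matrix (Fin (nR q)) (Fin (nR q)) ℂ)
    (s : (q : Fin Q) → Fin (nR q) → ℝ)
    (V : (q : Fin Q) → Matrix (Fin (nT q)) (Fin (nR q)) ℂ)
    (hSVD : ∀ q, IsCompactSVD (G.H q q) (U q) (s q) (V q))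
    -- the reduced direct channels, which are square, are nonsingular
    (hH : ∀ q, IsUnit ((G.reduce V).H q q))
    (hp : ∀ Y ∈ (G.reduce V).profileSet, ∀ Y' ∈ (G.reduce V).profileSet, Y ≠ Y' →
      ‖(G.reduce V).powerMap Y - (G.reduce V).powerMap Y'‖ <
        (1 - specRadius ((symmPart (G.reduce V).interferenceMatrix).map Complex.ofReal)) /
          sigmaMax ((1 + (G.reduce V).interferenceMatrix).map Complex.ofReal) *
          profileNorm (Y - Y')) :
    ∃! Y : Profile nT, G.IsNashEquilibrium Y := by
  have hV : ∀ q, (V q)ᴴ * V q = 1 := fun q => (hSVD q).2.1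
  have hHV : ∀ q, G.H q q = G.H q q * V q * (V q)ᴴ := by
    intro q
    conv_rhs => rw [(hSVD q).2.2.2]
    rw [Matrix.mul_assoc _ (V q)ᴴ, hV, Matrix.mul_one, ← (hSVD q).2.2.2]
  have key := MIMONetwork.isNashEquilibrium_iff_exists_expand (G := G) hnR hV hHV hH
  obtain ⟨Z, hZ, huniq⟩ := MIMONetwork.existsUnique_nash hnR hH hp
  refine ⟨MIMONetwork.expand V Z, (key _).2 ⟨Z, hZ, rfl⟩, fun Y hY => ?_⟩
  obtain ⟨Z', hZ', rfl⟩ := (key Y).1 hY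
  rw [huniq Z' hZ']
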